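/- Let $f:\mathbb{R}^n\to\mathbb{R}$ be convex and differentiable with $L_f$-Lipschitz gradient ($L_f>0$), let $\mathcal{C}\subseteq\mathbb{R}^n$ be compact and convex, and let $g_1,\dots,g_m:\mathbb{R}^n\to\mathbb{R}$ be convex and differentiable, where $\nabla g_i$ is Lipschitz on $\mathcal{C}$ with constant $L_{g_i}>0$. Consider $$\min_{x\in\mathbb{R}^n} f(x)+h(x)\quad\text{s.t.}\quad g(x):=(g_1(x),\dots,g_m(x))\le 0,\qquad h=\mathrm{Ind}_{\mathcal C},$$ with optimal value $L^*$, and assume that it has a KKT point, i.e. $x^*\in\mathcal{C}$, $z^*\in\mathbb{R}^m_+$ with $0\in\nabla f(x^*)+\mathcal{N}_{\mathcal C}(x^*)+\sum_i z_i^*\nabla g_i(x^*)$, $g(x^*)\le 0$ and $\langle z^*,g(x^*)\rangle=0$. Let $B_i>0$ satisfy $\|\nabla g_i(x)\|\le B_i$ and $|g_i(x)-g_i(x')|\le B_i\|x-x'\|$ for all $x,x'\in\mathcal{C}$. For $\lambda>0$ and $z\in\mathbb{R}^m_+$ put $$F_\lambda(x,z)=f(x)+\frac{\lambda}{2}\sum_{i=1}^m\Big(\big[g_i(x)+\tfrac{z_i}{\lambda}\big]_+^2-\big(\tfrac{z_i}{\lambda}\big)^2\Big),\quad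 \mathcal{L}_\lambda(x,z)=F_\lambda(x,z)+h(x),\quad L_\Psi(x,z)=\sum_{i=1}^m\big(\lambda B_i^2+L_{g_i}[\lambda g_i(x)+z_i]_+\big)$$ (the parameter $\lambda$ being understood in $L_\Psi$). Assume further that: (a) $\mathcal{C}$ is $(\nu,q)$-uniformly convex for some $\nu>0$, $q\ge 2$, i.e. $tx+(1-t)y+t(1-t)\nu\|x-y\|^q w\in\mathcal{C}$ for all $x,y\in\mathcal{C}$, $t\in[0,1]$ and $w\in\mathbb{R}^n$ with $\|w\|=1$ (strongly convex when $q=2$); (b) for some $\epsilon>0$, $\inf\|\nabla f(x)+\sum_i z_i\nabla g_i(x)\|>0$, where the infimum is over all $x\in\mathcal{C}$ and $z\in\mathbb{R}^m_+$ such that, for every $i$, $g_i(x)\le\epsilon$, and $z_i=0$ whenever $g_i(x)<-\epsilon$. Let $x^0\in\mathcal{C}$, $z^0\in\mathbb{R}^m_+$, and for $k\ge 0$ let $$v^k\in\operatorname*{Arg\,min}_{v\in\mathcal{C}}\langle\nabla_xF_{\lambda_k}(x^k,z^k),v\rangle,\quad x^{k+1}=x^k+\alpha_k(v^k-x^k),\quad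 z^{k+1}=z^k+\sigma_k\max\{-z^k/\lambda_k,\,g(x^{k+1})\}$$ (maximum componentwise), where: $\{\lambda_k\}$ is positive and strictly increasing, $\lambda_k=\Theta(k^\tau)$ and $\lambda_{k+1}-\lambda_k=\mathcal{O}(k^{-(1-\tau)})$ for some $\tau\in(0,1)$; $0<\sigma_k\le\lambda_k$ and $\sigma_k=\Theta(k^{-(1+\gamma)})$ for some $\gamma>0$; and $\alpha_k$ is the short stepsize, i.e., with $G_k=\langle\nabla_xF_{\lambda_k}(x^k,z^k),x^k-v^k\rangle$, $\alpha_k=0$ if $G_k=\|v^k-x^k\|=0$ and otherwise $$\alpha_k=\min\Big\{1,\ \frac{G_k}{(L_\Psi(x^k,z^k)+L_f)\|v^k-x^k\|^2}\Big\}\qquad(\text{with }\lambda=\lambda_k\text{ in }L_\Psi).$$ Set $T_k=[\mathcal{L}_{\lambda_k}(x^k,z^k)-L^*]_+$ and $\mu=1-2/q\in[0,1)$. Then $x^k\in\mathcal{C}$ for all $k$, and as $k\to\infty$ $$T_k=\mathcal{O}\big(\max\{k^{-\frac{1}{1+\mu}},k^{-\frac{2-2\tau}{1+\mu}}\}\big),$$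 $$\max\{|f(x^k)+h(x^k)-L^*|,\ \|[g(x^k)]_+\|\}=\mathcal{O}\big(\max\{k^{-\frac{1}{1+\mu}},k^{-\frac{2-2\tau}{1+\mu}},k^{-\tau}\}\big).$$ In particular, if $q=2$ (strongly convex $\mathcal{C}$) and $\tau=2/3$, the last quantity is $\mathcal{O}(k^{-2/3})$. -/

import Mathlib

open Filter Asymptotics
open scoped Gradient

/-- `ℝᵈ` with the Euclidean inner product and norm. -/
abbrev E (d : ℕ) : Type := EuclideanSpace ℝ (Fin d)

namespace CGAL

noncomputable section

/-- `(ν, q)`-uniform convexity of a convex set in `ℝⁿ` (`q = 2` is strong convexity). -/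
structure UniformlyConvexSet {n : ℕ} (ν q : ℝ) (C : Set (E n)) : Prop where
  q_ge : 2 ≤ q
  nu_pos : 0 < ν
  convex : Convex ℝ C
  mem : ∀ x ∈ C, ∀ y ∈ C, ∀ t : ℝ, 0 ≤ t → t ≤ 1 → ∀ w : E n, ‖w‖ = 1 →
    t • x + (1 - t) • y + (t * (1 - t) * ν * ‖x - y‖ ^ q) • w ∈ C

/-- The normal cone `∂ Ind_C (x)` of `C` at `x`; it is empty for `x ∉ C`. -/
def normalCone {n : ℕ} (C : Set (E n)) (x : E n) : Set (E n) :=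
  {v | x ∈ C ∧ ∀ y ∈ C, inner ℝ v (y - x) ≤ 0}

/-- Minimizers over `C` of the linear functional `v ↦ ⟨u, v⟩`, that is, minimizers over `ℝⁿ` of
`v ↦ ⟨u, v⟩ + Ind_C (v)` (linear minimization oracle). -/
def lmo {n : ℕ} (C : Set (E n)) (u : E n) : Set (E n) :=
  {v | v ∈ C ∧ ∀ y ∈ C, inner ℝ u v ≤ inner ℝ u y}

/-- The feasible set of `min f(x) + Ind_C(x)` subject to `g(x) ≤ 0`. -/
def feasible {n m : ℕ} (g : Fin m → E n → ℝ) (C : Set (E n)) : Set (E n) :=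
  {x | x ∈ C ∧ ∀ i, g i x ≤ 0}

/-- The optimal value `L*` of `min f(x) + Ind_C(x)` subject to `g(x) ≤ 0`. -/
def optVal {n m : ℕ} (f : E n → ℝ) (g : Fin m → E n → ℝ) (C : Set (E n)) : ℝ :=
  sInf (f '' feasible g C)

/-- `(x, z)` is a KKT point of `min f(x) + Ind_C(x)` subject to `g(x) ≤ 0`. -/
structure IsKKT {n m : ℕ} (f : E n → ℝ) (g : Fin m → E n → ℝ) (C : Set (E n))
    (x : E n) (z : E m) : Prop where
  stationary : ∃ w ∈ normalCone C x, ∇ f x + w + ∑ i, z i • ∇ (g i) x = 0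
  primal : ∀ i, g i x ≤ 0
  dual : ∀ i, 0 ≤ z i
  compl : ∑ i, z i * g i x = 0

/-- The standing assumptions on `f`, `g` and `h = Ind_C`, with Lipschitz moduli `Lf` and `Lg i`
of the gradients. -/
structure ProblemAssumption {n m : ℕ} (f : E n → ℝ) (g : Fin m → E n → ℝ) (C : Set (E n))
    (Lf : ℝ) (Lg : Fin m → ℝ) : Prop where
  f_convex : ConvexOn ℝ Set.univ f
  f_diff : Differentiable ℝ f
  Lf_pos : 0 < Lf
  f_lip : ∀ x y, ‖∇ f x - ∇ f y‖ ≤ Lf * ‖x - y‖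
  C_compact : IsCompact C
  C_convex : Convex ℝ C
  g_convex : ∀ i, ConvexOn ℝ Set.univ (g i)
  g_diff : ∀ i, Differentiable ℝ (g i)
  Lg_pos : ∀ i, 0 < Lg i
  g_lip : ∀ i, ∀ x ∈ C, ∀ y ∈ C, ‖∇ (g i) x - ∇ (g i) y‖ ≤ Lg i * ‖x - y‖
  kkt : ∃ x z, IsKKT f g C x z

/-- `B i > 0` bounds the gradient of `g i` on `C` and is a Lipschitz constant of `g i` on `C`. -/
structure GradBound {n m : ℕ} (g : Fin m → E n → ℝ) (C : Set (E n)) (B : Fin m → ℝ) : Prop where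
  pos : ∀ i, 0 < B i
  grad_le : ∀ i, ∀ x ∈ C, ‖∇ (g i) x‖ ≤ B i
  lip : ∀ i, ∀ x ∈ C, ∀ y ∈ C, |g i x - g i y| ≤ B i * ‖x - y‖

/-- The set `𝒜_ε`. -/
def setA {n m : ℕ} (g : Fin m → E n → ℝ) (ε : ℝ) : Set (E n × E m) :=
  {p | (∀ i, g i p.1 ≤ ε) ∧ (∀ i, 0 ≤ p.2 i) ∧ ∀ i, g i p.1 < -ε → p.2 i = 0}

/-- For some `ε > 0`, the norm of the gradient of the Lagrangian `f + ∑ zᵢ gᵢ` has a positive lower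
bound (equivalently, a positive infimum) over `(x, z) ∈ 𝒜_ε` with `x ∈ C`. -/
def LagrangianGradBoundedAway {n m : ℕ} (f : E n → ℝ) (g : Fin m → E n → ℝ)
    (C : Set (E n)) : Prop :=
  ∃ ε : ℝ, 0 < ε ∧ ∃ ζ : ℝ, 0 < ζ ∧ ∀ (x : E n) (z : E m), (x, z) ∈ setA g ε → x ∈ C →
    ζ ≤ ‖∇ f x + ∑ i, z i • ∇ (g i) x‖

/-- `Ψ_l(x, z) = (l / 2) ∑ᵢ ([gᵢ(x) + zᵢ / l]₊² - (zᵢ / l)²)`. -/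
def Psi {n m : ℕ} (g : Fin m → E n → ℝ) (l : ℝ) (x : E n) (z : E m) : ℝ :=
  l / 2 * ∑ i, ((max (g i x + z i / l) 0) ^ 2 - (z i / l) ^ 2)

/-- `F_l(x, z) = f(x) + Ψ_l(x, z)`. For `x ∈ C` this is also the value of the augmented Lagrangian
`𝓛_l(x, z) = f(x) + Ψ_l(x, z) + Ind_C(x)`. -/
def F {n m : ℕ} (f : E n → ℝ) (g : Fin m → E n → ℝ) (l : ℝ) (x : E n) (z : E m) : ℝ :=
  f x + Psi g l x z

/-- `∇ₓ F_l(x, z)`. -/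
def gradF {n m : ℕ} (f : E n → ℝ) (g : Fin m → E n → ℝ) (l : ℝ) (x : E n) (z : E m) : E n :=
  ∇ (fun y => F f g l y z) x

/-- The gap `⟨∇ₓ F_l(x, z), x - v⟩`, for `x ∈ C` and `v` a minimizer of `⟨∇ₓ F_l(x, z), ·⟩`
over `C`. -/
def gap {n m : ℕ} (f : E n → ℝ) (g : Fin m → E n → ℝ) (l : ℝ) (x : E n) (z : E m) (v : E n) : ℝ :=
  inner ℝ (gradF f g l x z) (x - v)

/-- `L_Ψ(x, z) = ∑ᵢ (l Bᵢ² + Lgᵢ [l gᵢ(x) + zᵢ]₊)`. -/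
def LPsi {n m : ℕ} (g : Fin m → E n → ℝ) (Lg B : Fin m → ℝ) (l : ℝ) (x : E n) (z : E m) : ℝ :=
  ∑ i, (l * B i ^ 2 + Lg i * max (l * g i x + z i) 0)

open Classical in
/-- The short stepsize. -/
def shortStep {n m : ℕ} (f : E n → ℝ) (g : Fin m → E n → ℝ) (Lf : ℝ) (Lg B : Fin m → ℝ)
    (l : ℝ) (x : E n) (z : E m) (v : E n) : ℝ :=
  if gap f g l x z v = 0 ∧ ‖v - x‖ = 0 then 0
  else min 1 (gap f g l x z v / ((LPsi g Lg B l x z + Lf) * ‖v - x‖ ^ 2))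

/-- `x, z, v` are generated by the single-loop conditional-gradient augmented-Lagrangian method
with stepsizes `α`, penalty parameters `lam` and dual stepsizes `σ`. -/
structure IsGenerated {n m : ℕ} (f : E n → ℝ) (g : Fin m → E n → ℝ) (C : Set (E n))
    (α lam σ : ℕ → ℝ) (x : ℕ → E n) (z : ℕ → E m) (v : ℕ → E n) : Prop where
  x_zero : x 0 ∈ C
  z_zero : ∀ i, 0 ≤ z 0 i
  alpha_mem : ∀ k, α k ∈ Set.Icc (0 : ℝ) 1
  lam_pos : ∀ k, 0 < lam k
  lam_mono : StrictMono lam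
  lam_tendsto : Tendsto lam atTop atTop
  sigma_pos : ∀ k, 0 < σ k
  sigma_summable : Summable σ
  sigma_le : ∀ k, σ k ≤ lam k
  v_mem : ∀ k, v k ∈ lmo C (gradF f g (lam k) (x k) (z k))
  x_succ : ∀ k, x (k + 1) = x k + α k • (v k - x k)
  z_succ : ∀ k i, z (k + 1) i = z k i + σ k * max (-(z k i / lam k)) (g i (x (k + 1)))

/-- The parameter choice for the short stepsize: `lam k = Θ(k ^ τ)`,
`lam (k+1) - lam k = O(k ^ (-(1 - τ)))`, `σ k = Θ(k ^ (-(1 + γ)))` for some `γ > 0`, and `α k` is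
the short stepsize. -/
structure ShortStepParams {n m : ℕ} (f : E n → ℝ) (g : Fin m → E n → ℝ) (Lf : ℝ)
    (Lg B : Fin m → ℝ) (τ : ℝ) (α lam σ : ℕ → ℝ)
    (x : ℕ → E n) (z : ℕ → E m) (v : ℕ → E n) : Prop where
  tau_mem : τ ∈ Set.Ioo (0 : ℝ) 1
  lam_theta : lam =Θ[atTop] fun k : ℕ => (k : ℝ) ^ τ
  lam_diff : (fun k : ℕ => lam (k + 1) - lam k) =O[atTop] fun k : ℕ => (k : ℝ) ^ (-(1 - τ))
  alpha_eq : ∀ k, α k = shortStep f g Lf Lg B (lam k) (x k) (z k) (v k)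
  sigma_theta : ∃ γ : ℝ, 0 < γ ∧ σ =Θ[atTop] fun k : ℕ => (k : ℝ) ^ (-(1 + γ))

/-- `T_l(x, z) = [𝓛_l(x, z) - L*]₊` for `x ∈ C`. -/
def T {n m : ℕ} (f : E n → ℝ) (g : Fin m → E n → ℝ) (C : Set (E n)) (l : ℝ)
    (x : E n) (z : E m) : ℝ :=
  max (F f g l x z - optVal f g C) 0

/-- The infeasibility `‖[g(x)]₊‖` (Euclidean norm). -/
def infeas {n m : ℕ} (g : Fin m → E n → ℝ) (x : E n) : ℝ :=
  ‖(WithLp.toLp 2 fun i => max (g i x) 0 : E m)‖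

end

end CGAL

/-!
Write `λ`, `z` for the penalty parameter and the multiplier, `T` for the positive part of the
augmented Lagrangian minus the optimal value, and `d = max {-z / λ, g(x)}`, so that `z + λ d` is the
multiplier of the augmented Lagrangian at `(x, z)`.

Convexity gives `T ≤ gap`, and the smoothness of the augmented Lagrangian along the segment from `x`
to `v`, with constant `L = L_Ψ + L_f = O(λ)`, shows that a short step decreases `T` by at least
`½ min {1, gap / (L ‖v - x‖²)} T`. If `‖v - x‖² ≤ A gap ^ (1 - μ)`, this is at least
`½ min {1, T ^ μ / (A L)} T`. The dual and penalty updates increase `T` by at most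
`(σₖ + (λₖ₊₁ - λₖ) / 2) ‖d‖²`, and testing against a dual solution bounds `‖d‖²` by a multiple of
`T / λ + 1 / λ²`. Altogether
`T⁺ ≤ (1 + O(1 / k)) (1 - ½ min {1, T ^ μ / (A L)}) T + O(k ^ (-(1 + τ)))`,
and `k ^ r T` remains bounded for every admissible `r`.

The recursion is used twice. Boundedness of `C` alone gives `μ = 1`, hence (with `r = 0`) that `T`
is bounded. Then `d → 0`, so that `(x, z + λ d)` eventually lies in every `𝒜_ε` and the gradient of
the augmented Lagrangian stays away from `0`; uniform convexity of `C` now gives the true exponent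
`μ = 1 - 2 / q`. The objective error and the infeasibility are `O(T + 1 / λ)`, again by weak
duality.
-/

namespace CGAL

section Gradient

variable {V : Type*} [NormedAddCommGroup V] [InnerProductSpace ℝ V] [CompleteSpace V]
  {f : V → ℝ} {C : Set V} {x y : V}

theorem hasDerivAt_comp_add_smul {d : V} {t : ℝ} (hf : DifferentiableAt ℝ f (x + t • d)) :
    HasDerivAt (fun s : ℝ => f (x + s • d)) (inner ℝ (∇ f (x + t • d)) d) t := by
  have hline : HasDerivAt (fun s : ℝ => x + s • d) d t := by
    simpa using ((hasDerivAt_id t).smul_const d).const_add x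
  exact hf.hasGradientAt.hasFDerivAt.comp_hasDerivAt t hline

theorem add_inner_gradient_le (hc : ConvexOn ℝ C f) (hf : DifferentiableAt ℝ f x)
    (hx : x ∈ C) (hy : y ∈ C) : f x + inner ℝ (∇ f x) (y - x) ≤ f y := by
  have hline := hc.comp_affineMap (AffineMap.lineMap x y : ℝ →ᵃ[ℝ] V)
  have hderiv : HasDerivAt (f ∘ (AffineMap.lineMap x y : ℝ →ᵃ[ℝ] V))
      (inner ℝ (∇ f x) (y - x)) 0 := by
    have h := hasDerivAt_comp_add_smul (d := y - x) (t := 0) (x := x) (by simpa using hf)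
    simpa [Function.comp_def, AffineMap.lineMap_apply, add_comm] using h
  have hslope := hline.le_slope_of_hasDerivAt (by simpa using hx) (by simpa using hy) one_pos hderiv
  simp only [slope_def_field, Function.comp_apply, AffineMap.lineMap_apply_one,
    AffineMap.lineMap_apply_zero, sub_zero, div_one] at hslope
  linarith

theorem le_add_inner_gradient_add_sq {K : ℝ} (hC : Convex ℝ C)
    (hf : ∀ x ∈ C, DifferentiableAt ℝ f x)
    (hK : ∀ x ∈ C, ∀ y ∈ C, ‖∇ f x - ∇ f y‖ ≤ K * ‖x - y‖) (hx : x ∈ C) (hy : y ∈ C) :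
    f y ≤ f x + inner ℝ (∇ f x) (y - x) + K / 2 * ‖y - x‖ ^ 2 := by
  set d := y - x with hd
  have hmem {t : ℝ} (ht : t ∈ Set.Icc (0 : ℝ) 1) : x + t • d ∈ C := hC.add_smul_sub_mem hx hy ht
  have hderiv {t : ℝ} (ht : t ∈ Set.Icc (0 : ℝ) 1) :=
    hasDerivAt_comp_add_smul (hf _ (hmem ht))
  have hbound (t : ℝ) : HasDerivAt
      (fun s : ℝ => f x + s * inner ℝ (∇ f x) d + K / 2 * ‖d‖ ^ 2 * s ^ 2)
      (inner ℝ (∇ f x) d + K * ‖d‖ ^ 2 * t) t := by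
    refine ((((hasDerivAt_id t).mul_const _).const_add _).add
      (((hasDerivAt_id t).pow 2).const_mul _)).congr_deriv ?_
    simp only [id_eq, one_mul, Nat.cast_ofNat, Nat.add_one_sub_one, pow_one, mul_one]
    ring
  have hle {t : ℝ} (ht : t ∈ Set.Ico (0 : ℝ) 1) :
      inner ℝ (∇ f (x + t • d)) d ≤ inner ℝ (∇ f x) d + K * ‖d‖ ^ 2 * t := by
    rw [← sub_le_iff_le_add', ← inner_sub_left]
    calc inner ℝ (∇ f (x + t • d) - ∇ f x) d
        ≤ ‖∇ f (x + t • d) - ∇ f x‖ * ‖d‖ := real_inner_le_norm _ _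
      _ ≤ K * ‖x + t • d - x‖ * ‖d‖ := by
          gcongr
          exact hK _ (hmem (Set.Ico_subset_Icc_self ht)) _ hx
      _ = K * ‖d‖ ^ 2 * t := by
          rw [add_sub_cancel_left, norm_smul, Real.norm_of_nonneg ht.1]
          ring
  have h := image_le_of_deriv_right_le_deriv_boundary
    (fun t ht => (hderiv ht).continuousAt.continuousWithinAt)
    (fun t ht => (hderiv (Set.Ico_subset_Icc_self ht)).hasDerivWithinAt) (by simp)
    (fun t _ => (hbound t).continuousAt.continuousWithinAt)
    (fun t _ => (hbound t).hasDerivWithinAt) (fun t ht => hle ht)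
    (Set.right_mem_Icc.2 zero_le_one)
  simpa [hd] using h

end Gradient

section PenaltyTerm

variable {l a a' ζ : ℝ}

/-- The contribution of one constraint to `Ψ_l(x, z)`, with `a = gᵢ(x)` and `ζ = zᵢ`; the factor
`l` is moved inside the positive part. -/
noncomputable def penaltyTerm (l a ζ : ℝ) : ℝ := (max (l * a + ζ) 0 ^ 2 - ζ ^ 2) / (2 * l)

theorem penaltyTerm_eq (hl : 0 < l) (a ζ : ℝ) :
    penaltyTerm l a ζ =
      max (l * a + ζ) 0 * a - (max (l * a + ζ) 0 - ζ) ^ 2 / (2 * l) := by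
  unfold penaltyTerm
  rcases max_choice (l * a + ζ) 0 with h | h <;> rw [h] <;> field_simp <;> ring

/-- With `penaltyTerm_eq`: `penaltyTerm l a ζ` is the maximum of `p * a - (p - ζ) ^ 2 / (2 * l)`
over `p ≥ 0`. -/
theorem le_penaltyTerm (hl : 0 < l) (a ζ : ℝ) {p : ℝ} (hp : 0 ≤ p) :
    p * a + ((max (l * a + ζ) 0 - p) ^ 2 - (ζ - p) ^ 2) / (2 * l) ≤ penaltyTerm l a ζ := by
  have h := mul_le_mul_of_nonneg_left (le_max_left (l * a + ζ) 0) hp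
  rw [penaltyTerm, ← sub_nonneg]
  have e (s : ℝ) : (s ^ 2 - ζ ^ 2) / (2 * l) - (p * a + ((s - p) ^ 2 - (ζ - p) ^ 2) / (2 * l)) =
      (p * s - p * (l * a + ζ)) / l := by
    field_simp
    ring
  rw [e]
  exact div_nonneg (sub_nonneg.2 h) hl.le

theorem penaltyTerm_nonpos (hl : 0 < l) (ha : a ≤ 0) (ζ : ℝ) : penaltyTerm l a ζ ≤ 0 := by
  rw [penaltyTerm_eq hl]
  exact sub_nonpos_of_le ((mul_nonpos_of_nonneg_of_nonpos (le_max_right _ _) ha).trans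
    (by positivity))

theorem penaltyTerm_add_mul_le (hl : 0 < l) (a a' ζ : ℝ) :
    penaltyTerm l a ζ + max (l * a + ζ) 0 * (a' - a) ≤ penaltyTerm l a' ζ := by
  have h := le_penaltyTerm hl a' ζ (le_max_right (l * a + ζ) 0)
  have hsq : 0 ≤ (max (l * a' + ζ) 0 - max (l * a + ζ) 0) ^ 2 / (2 * l) := by positivity
  rw [sub_div, sub_sq_comm ζ] at h
  rw [penaltyTerm_eq hl a]
  linarith

theorem penaltyTerm_le_add_sq (hl : 0 < l) (a a' ζ : ℝ) :
    penaltyTerm l a' ζ ≤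
      penaltyTerm l a ζ + max (l * a + ζ) 0 * (a' - a) + l / 2 * (a' - a) ^ 2 := by
  have h := le_penaltyTerm hl a ζ (le_max_right (l * a' + ζ) 0)
  rw [penaltyTerm_eq hl a']
  set p := max (l * a + ζ) 0
  set p' := max (l * a' + ζ) 0
  have hyoung : (p' - p) * (a' - a) ≤ (p - p') ^ 2 / (2 * l) + l / 2 * (a' - a) ^ 2 := by
    rw [← sub_nonneg]
    have e : (p - p') ^ 2 / (2 * l) + l / 2 * (a' - a) ^ 2 - (p' - p) * (a' - a) =
        (p' - p - l * (a' - a)) ^ 2 / (2 * l) := by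
      field_simp
      ring
    rw [e]
    positivity
  rw [sub_div, sub_sq_comm ζ] at h
  linarith

theorem hasDerivAt_penaltyTerm (hl : 0 < l) (a ζ : ℝ) :
    HasDerivAt (fun a => penaltyTerm l a ζ) (max (l * a + ζ) 0) a := by
  refine hasDerivAt_iff_isLittleO.2 (IsBigO.trans_isLittleO ?_
    (isLittleO_pow_sub_sub a one_lt_two))
  refine IsBigO.of_bound (l / 2) (Eventually.of_forall fun a' => ?_)
  have hlower := penaltyTerm_add_mul_le hl a a' ζ
  have hupper := penaltyTerm_le_add_sq hl a a' ζ
  simp only [smul_eq_mul, Real.norm_eq_abs, abs_pow, sq_abs]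
  rw [abs_of_nonneg (by linarith)]
  linarith

theorem max_mul_add_zero_eq (hl : 0 < l) (a ζ : ℝ) :
    max (l * a + ζ) 0 = ζ + l * max (-(ζ / l)) a := by
  rw [mul_max_of_nonneg _ _ hl.le, mul_neg, mul_div_cancel₀ _ hl.ne', ← max_add_add_left,
    add_neg_cancel, max_comm, add_comm ζ]

/-- The supergradient inequality of the jointly concave function `(ζ, l) ↦ penaltyTerm l a ζ`. -/
theorem penaltyTerm_le_add {l' : ℝ} (hl : 0 < l) (hl' : 0 < l') (a ζ ζ' : ℝ) :
    penaltyTerm l' a ζ' ≤ penaltyTerm l a ζ + max (-(ζ / l)) a * (ζ' - ζ)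
      + max (-(ζ / l)) a ^ 2 / 2 * (l' - l) := by
  have h := le_penaltyTerm hl a ζ (le_max_right (l' * a + ζ') 0)
  rw [max_mul_add_zero_eq hl] at h
  rw [penaltyTerm_eq hl' a]
  set u := max (-(ζ / l)) a
  set p' := max (l' * a + ζ') 0
  have hexpand : ((ζ + l * u - p') ^ 2 - (ζ - p') ^ 2) / (2 * l) =
      u * (ζ - p') + l / 2 * u ^ 2 := by
    field_simp
    ring
  have hyoung : u * (p' - ζ') ≤ (p' - ζ') ^ 2 / (2 * l') + l' / 2 * u ^ 2 := by
    rw [← sub_nonneg]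
    have e : (p' - ζ') ^ 2 / (2 * l') + l' / 2 * u ^ 2 - u * (p' - ζ') =
        (p' - ζ' - l' * u) ^ 2 / (2 * l') := by
      field_simp
      ring
    rw [e]
    positivity
  rw [hexpand] at h
  linarith

end PenaltyTerm

section AugmentedLagrangian

variable {n m : ℕ} {f : E n → ℝ} {g : Fin m → E n → ℝ} {C : Set (E n)} {Lf : ℝ}
  {Lg B : Fin m → ℝ} {l l' : ℝ} {x : E n}

/-- `∑ᵢ pᵢ ∇gᵢ(x)` with `p = multiplier g l x z` is the gradient of `Ψ_l(·, z)` at `x`; `p` is also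
the dual iterate that a full step of the method of multipliers would produce. -/
noncomputable def multiplier (g : Fin m → E n → ℝ) (l : ℝ) (x : E n) (z : E m) : E m :=
  WithLp.toLp 2 fun i => max (l * g i x + z i) 0

/-- The direction `max {-z / l, g(x)}` of the dual update, which is also `∇_z Ψ_l(x, z)`. -/
noncomputable def dualDirection (g : Fin m → E n → ℝ) (l : ℝ) (x : E n) (z : E m) : E m :=
  WithLp.toLp 2 fun i => max (-(z i / l)) (g i x)

theorem multiplier_eq (hl : 0 < l) (x : E n) (z : E m) :
    multiplier g l x z = z + l • dualDirection g l x z := by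
  ext i
  exact max_mul_add_zero_eq hl (g i x) (z i)

theorem multiplier_nonneg (x : E n) (z : E m) (i : Fin m) : 0 ≤ multiplier g l x z i :=
  le_max_right _ _

theorem Psi_eq (hl : 0 < l) (x : E n) (z : E m) :
    Psi g l x z = ∑ i, penaltyTerm l (g i x) (z i) := by
  rw [Psi, Finset.mul_sum]
  refine Finset.sum_congr rfl fun i _ => ?_
  have h : max (g i x + z i / l) 0 = max (l * g i x + z i) 0 / l := by
    rw [← max_div_div_right hl.le, zero_div, add_div, mul_div_cancel_left₀ _ hl.ne']
  rw [h, penaltyTerm]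
  field_simp

theorem gradF_eq (hf : DifferentiableAt ℝ f x) (hg : ∀ i, DifferentiableAt ℝ (g i) x)
    (hl : 0 < l) (z : E m) :
    gradF f g l x z = ∇ f x + ∑ i, multiplier g l x z i • ∇ (g i) x := by
  refine HasGradientAt.gradient (hasGradientAt_iff_hasFDerivAt.2 ?_)
  have hterm (i : Fin m) := (hasDerivAt_penaltyTerm hl (g i x) (z i)).comp_hasFDerivAt x
    (hg i).hasGradientAt.hasFDerivAt
  have h := hf.hasGradientAt.hasFDerivAt.add
    (HasFDerivAt.fun_sum (u := Finset.univ) fun i _ => hterm i)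
  simp only [F, Psi_eq hl]
  refine h.congr_fderiv ?_
  simp only [map_add, map_sum, map_smul, multiplier]

theorem le_Psi (hl : 0 < l) (x : E n) (z : E m) {w : E m} (hw : ∀ i, 0 ≤ w i) :
    ∑ i, w i * g i x + (‖multiplier g l x z - w‖ ^ 2 - ‖z - w‖ ^ 2) / (2 * l) ≤ Psi g l x z := by
  rw [Psi_eq hl, EuclideanSpace.real_norm_sq_eq, EuclideanSpace.real_norm_sq_eq,
    ← Finset.sum_sub_distrib, Finset.sum_div, ← Finset.sum_add_distrib]
  exact Finset.sum_le_sum fun i _ => le_penaltyTerm hl (g i x) (z i) (hw i)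

theorem Psi_le_add (hl : 0 < l) (hl' : 0 < l') (x : E n) (z z' : E m) :
    Psi g l' x z' ≤ Psi g l x z + inner ℝ (dualDirection g l x z) (z' - z)
      + (l' - l) / 2 * ‖dualDirection g l x z‖ ^ 2 := by
  rw [Psi_eq hl, Psi_eq hl', EuclideanSpace.real_norm_sq_eq, Finset.mul_sum, PiLp.inner_apply,
    ← Finset.sum_add_distrib, ← Finset.sum_add_distrib]
  refine Finset.sum_le_sum fun i _ => (penaltyTerm_le_add hl hl' (g i x) (z i) (z' i)).trans_eq ?_
  simp only [dualDirection, PiLp.sub_apply, RCLike.inner_apply, conj_trivial]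
  ring

theorem Psi_nonpos (hl : 0 < l) (hx : ∀ i, g i x ≤ 0) (z : E m) : Psi g l x z ≤ 0 := by
  rw [Psi_eq hl]
  exact Finset.sum_nonpos fun i _ => penaltyTerm_nonpos hl (hx i) (z i)

theorem infeas_le_norm_dualDirection (hl : 0 < l) (x : E n) {z : E m} (hz : ∀ i, 0 ≤ z i) :
    infeas g x ≤ ‖dualDirection g l x z‖ := by
  rw [infeas, ← sq_le_sq₀ (norm_nonneg _) (norm_nonneg _), EuclideanSpace.real_norm_sq_eq,
    EuclideanSpace.real_norm_sq_eq]
  refine Finset.sum_le_sum fun i _ => ?_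
  simp only [dualDirection]
  rcases le_total (g i x) 0 with h | h
  · rw [max_eq_right h, zero_pow two_ne_zero]
    positivity
  · rw [max_eq_left h, max_eq_right ((neg_nonpos.2 (div_nonneg (hz i) hl.le)).trans h)]

/-- The regularity of `f` and `g` on the constraint set `C` that the method needs: convexity,
Lipschitz gradients with moduli `Lf` and `Lg i`, and Lipschitz moduli `B i` of the `g i`. -/
structure SmoothConvexProblem (f : E n → ℝ) (g : Fin m → E n → ℝ) (C : Set (E n)) (Lf : ℝ)
    (Lg B : Fin m → ℝ) : Prop where
  f_convex : ConvexOn ℝ C f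
  f_diff : ∀ x ∈ C, DifferentiableAt ℝ f x
  Lf_pos : 0 < Lf
  f_grad_lip : ∀ x ∈ C, ∀ y ∈ C, ‖∇ f x - ∇ f y‖ ≤ Lf * ‖x - y‖
  g_convex : ∀ i, ConvexOn ℝ C (g i)
  g_diff : ∀ i, ∀ x ∈ C, DifferentiableAt ℝ (g i) x
  Lg_nonneg : ∀ i, 0 ≤ Lg i
  g_grad_lip : ∀ i, ∀ x ∈ C, ∀ y ∈ C, ‖∇ (g i) x - ∇ (g i) y‖ ≤ Lg i * ‖x - y‖
  g_lip : ∀ i, ∀ x ∈ C, ∀ y ∈ C, |g i x - g i y| ≤ B i * ‖x - y‖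

namespace SmoothConvexProblem

theorem inner_gradF (hP : SmoothConvexProblem f g C Lf Lg B) (hl : 0 < l) (hx : x ∈ C)
    (z : E m) (d : E n) : inner ℝ (gradF f g l x z) d =
      inner ℝ (∇ f x) d + ∑ i, multiplier g l x z i * inner ℝ (∇ (g i) x) d := by
  simp only [gradF_eq (hP.f_diff x hx) (fun i => hP.g_diff i x hx) hl, inner_add_left, sum_inner,
    real_inner_smul_left]

theorem F_add_inner_gradF_le (hP : SmoothConvexProblem f g C Lf Lg B) (hl : 0 < l)
    (hx : x ∈ C) {y : E n} (hy : y ∈ C) (z : E m) :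
    F f g l x z + inner ℝ (gradF f g l x z) (y - x) ≤ F f g l y z := by
  have hf := add_inner_gradient_le hP.f_convex (hP.f_diff x hx) hx hy
  have hterm (i : Fin m) : penaltyTerm l (g i x) (z i)
      + multiplier g l x z i * inner ℝ (∇ (g i) x) (y - x) ≤ penaltyTerm l (g i y) (z i) := by
    have hg := mul_le_mul_of_nonneg_left
      (add_inner_gradient_le (hP.g_convex i) (hP.g_diff i x hx) hx hy)
      (multiplier_nonneg (g := g) (l := l) x z i)
    have hpen := penaltyTerm_add_mul_le hl (g i x) (g i y) (z i)
    change _ + multiplier g l x z i * _ ≤ _ at hpen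
    linarith
  have hsum := Finset.sum_le_sum fun i (_ : i ∈ Finset.univ) => hterm i
  rw [Finset.sum_add_distrib] at hsum
  rw [F, F, Psi_eq hl, Psi_eq hl, hP.inner_gradF hl hx]
  linarith

theorem F_le_add_inner_gradF_add_sq (hP : SmoothConvexProblem f g C Lf Lg B) (hl : 0 < l)
    (hx : x ∈ C) {y : E n} (hy : y ∈ C) (z : E m) :
    F f g l y z ≤ F f g l x z + inner ℝ (gradF f g l x z) (y - x)
      + (LPsi g Lg B l x z + Lf) / 2 * ‖y - x‖ ^ 2 := by
  have hf := le_add_inner_gradient_add_sq hP.f_convex.1 hP.f_diff hP.f_grad_lip hx hy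
  have hterm (i : Fin m) : penaltyTerm l (g i y) (z i) ≤ penaltyTerm l (g i x) (z i)
      + multiplier g l x z i * inner ℝ (∇ (g i) x) (y - x)
      + (l * B i ^ 2 + Lg i * multiplier g l x z i) / 2 * ‖y - x‖ ^ 2 := by
    have hg := mul_le_mul_of_nonneg_left (le_add_inner_gradient_add_sq hP.f_convex.1
      (hP.g_diff i) (hP.g_grad_lip i) hx hy) (multiplier_nonneg (g := g) (l := l) x z i)
    have hsq : l / 2 * (g i y - g i x) ^ 2 ≤ l / 2 * (B i * ‖y - x‖) ^ 2 := by
      have hlip := hP.g_lip i y hy x hx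
      exact mul_le_mul_of_nonneg_left (sq_le_sq' (neg_le_of_abs_le hlip) (le_of_abs_le hlip))
        (half_pos hl).le
    have hpen := penaltyTerm_le_add_sq hl (g i x) (g i y) (z i)
    change _ ≤ _ + multiplier g l x z i * _ + _ at hpen
    linarith
  have hsum := Finset.sum_le_sum fun i (_ : i ∈ Finset.univ) => hterm i
  rw [Finset.sum_add_distrib, Finset.sum_add_distrib, ← Finset.sum_mul, ← Finset.sum_div] at hsum
  rw [F, F, Psi_eq hl, Psi_eq hl, hP.inner_gradF hl hx]
  change _ ≤ _ + (∑ i, (l * B i ^ 2 + Lg i * multiplier g l x z i) + Lf) / 2 * ‖y - x‖ ^ 2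
  linarith

theorem LPsi_add_pos (hP : SmoothConvexProblem f g C Lf Lg B) (hl : 0 < l) (x : E n) (z : E m) :
    0 < LPsi g Lg B l x z + Lf :=
  add_pos_of_nonneg_of_pos (Finset.sum_nonneg fun i _ => add_nonneg (by positivity)
    (mul_nonneg (hP.Lg_nonneg i) (le_max_right _ _))) hP.Lf_pos

theorem sub_optVal_le_gap (hP : SmoothConvexProblem f g C Lf Lg B)
    (hne : (feasible g C).Nonempty) (hl : 0 < l) (hx : x ∈ C) (z : E m) {v : E n}
    (hv : v ∈ lmo C (gradF f g l x z)) : F f g l x z - optVal f g C ≤ gap f g l x z v := by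
  suffices h : F f g l x z - gap f g l x z v ≤ optVal f g C by linarith
  refine le_csInf (hne.image f) ?_
  rintro _ ⟨y, ⟨hyC, hy⟩, rfl⟩
  have hconv := hP.F_add_inner_gradF_le hl hx hyC z
  have hmin := hv.2 y hyC
  have hPsi := Psi_nonpos hl hy z
  rw [inner_sub_right] at hconv
  rw [gap, inner_sub_right]
  change _ ≤ f y + Psi g l y z at hconv
  linarith

theorem bddAbove_g (hP : SmoothConvexProblem f g C Lf Lg B) (hC : Bornology.IsBounded C) :
    ∃ M : ℝ, ∀ x ∈ C, ∀ i, g i x ≤ M := by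
  have hbdd (i : Fin m) : ∃ M, ∀ x ∈ C, g i x ≤ M := by
    rcases C.eq_empty_or_nonempty with rfl | ⟨y, hy⟩
    · simp
    obtain ⟨R, hR⟩ := Metric.isBounded_iff.1 hC
    refine ⟨g i y + |B i| * R, fun x hx => ?_⟩
    have hdist : B i * ‖x - y‖ ≤ |B i| * R := mul_le_mul (le_abs_self _)
      (dist_eq_norm x y ▸ hR hx hy) (norm_nonneg _) (abs_nonneg _)
    linarith [le_of_abs_le (hP.g_lip i x hx y hy)]
  choose M hM using hbdd
  obtain ⟨K, hK⟩ := (Set.finite_range M).bddAbove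
  exact ⟨K, fun x hx i => (hM i x hx).trans (hK ⟨i, rfl⟩)⟩

end SmoothConvexProblem

end AugmentedLagrangian

section Duality

variable {n m : ℕ} {f : E n → ℝ} {g : Fin m → E n → ℝ} {C : Set (E n)} {l l' : ℝ}
  {x : E n} {zs : E m}

theorem T_nonneg (f : E n → ℝ) (g : Fin m → E n → ℝ) (C : Set (E n)) (l : ℝ) (x : E n)
    (z : E m) : 0 ≤ T f g C l x z :=
  le_max_right _ _

theorem sub_optVal_le_T (f : E n → ℝ) (g : Fin m → E n → ℝ) (C : Set (E n)) (l : ℝ) (x : E n)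
    (z : E m) : F f g l x z - optVal f g C ≤ T f g C l x z :=
  le_max_left _ _

theorem T_dual_update_le (hl : 0 < l) (hl' : l ≤ l') {s : ℝ} (hs : 0 ≤ s) (x : E n) (z : E m) :
    T f g C l' x (z + s • dualDirection g l x z) ≤
      T f g C l x z + (s + (l' - l) / 2) * ‖dualDirection g l x z‖ ^ 2 := by
  have hPsi := Psi_le_add (g := g) hl (hl.trans_le hl') x z (z + s • dualDirection g l x z)
  rw [add_sub_cancel_left, real_inner_smul_right, real_inner_self_eq_norm_sq] at hPsi
  have hT := sub_optVal_le_T f g C l x z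
  refine max_le ?_ (add_nonneg (T_nonneg f g C l x z)
    (mul_nonneg (by linarith) (sq_nonneg _)))
  rw [F] at hT ⊢
  linarith

/-- A dual solution `zs` attaining the optimal value, so that there is no duality gap. -/
structure IsDualOptimal (f : E n → ℝ) (g : Fin m → E n → ℝ) (C : Set (E n)) (zs : E m) :
    Prop where
  nonneg : ∀ i, 0 ≤ zs i
  optVal_le : ∀ x ∈ C, optVal f g C ≤ f x + ∑ i, zs i * g i x

namespace IsDualOptimal

theorem norm_multiplier_sub_sq_le (hd : IsDualOptimal f g C zs) (hl : 0 < l) (hx : x ∈ C)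
    (z : E m) :
    ‖multiplier g l x z - zs‖ ^ 2 ≤ 2 * l * T f g C l x z + ‖z - zs‖ ^ 2 := by
  have hPsi := le_Psi (g := g) hl x z hd.nonneg
  have hval := hd.optVal_le x hx
  have hT := sub_optVal_le_T f g C l x z
  rw [F] at hT
  have h : (‖multiplier g l x z - zs‖ ^ 2 - ‖z - zs‖ ^ 2) / (2 * l) ≤ T f g C l x z := by linarith
  rw [div_le_iff₀' (by positivity)] at h
  linarith

theorem norm_dualDirection_sq_le (hd : IsDualOptimal f g C zs) (hl : 0 < l) (hx : x ∈ C)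
    (z : E m) :
    ‖dualDirection g l x z‖ ^ 2 ≤ 4 * T f g C l x z / l + 4 * ‖z - zs‖ ^ 2 / l ^ 2 := by
  have hsmul : l * ‖dualDirection g l x z‖ ≤ ‖multiplier g l x z - zs‖ + ‖z - zs‖ := by
    rw [← Real.norm_of_nonneg hl.le, ← norm_smul, ← add_sub_cancel_left z (l • _),
      Real.norm_of_nonneg hl.le, ← multiplier_eq hl]
    exact norm_sub_le_norm_sub_add_norm_sub _ zs z |>.trans_eq (by rw [norm_sub_rev zs])
  have hmult := hd.norm_multiplier_sub_sq_le hl hx z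
  have hsq := pow_le_pow_left₀ (by positivity) hsmul 2
  have h : l ^ 2 * ‖dualDirection g l x z‖ ^ 2 ≤ 4 * l * T f g C l x z + 4 * ‖z - zs‖ ^ 2 := by
    rw [← mul_pow]
    linarith [add_sq_le (a := ‖multiplier g l x z - zs‖) (b := ‖z - zs‖)]
  rw [← le_div_iff₀' (by positivity)] at h
  refine h.trans_eq ?_
  field_simp

theorem infeas_le (hd : IsDualOptimal f g C zs) (hl : 0 < l) (hx : x ∈ C) {z : E m}
    (hz : ∀ i, 0 ≤ z i) :
    infeas g x ≤ T f g C l x z + 2 * (1 + ‖z - zs‖) / l := by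
  have hT := T_nonneg f g C l x z
  refine (infeas_le_norm_dualDirection hl x hz).trans
    ((sq_le_sq₀ (norm_nonneg _) (by positivity)).1 ?_)
  refine (hd.norm_dualDirection_sq_le hl hx z).trans ?_
  have e : (T f g C l x z + 2 * (1 + ‖z - zs‖) / l) ^ 2 =
      4 * T f g C l x z / l + 4 * ‖z - zs‖ ^ 2 / l ^ 2 + (T f g C l x z ^ 2
        + 4 * T f g C l x z * ‖z - zs‖ / l + 4 * (1 + 2 * ‖z - zs‖) / l ^ 2) := by
    field_simp
    ring
  rw [e]
  exact le_add_of_nonneg_right (by positivity)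

theorem abs_sub_optVal_le (hd : IsDualOptimal f g C zs) (hl : 0 < l) (hx : x ∈ C) (z : E m) :
    |f x - optVal f g C| ≤ T f g C l x z + ‖z‖ ^ 2 / (2 * l) + ‖zs‖ * infeas g x := by
  have hT := T_nonneg f g C l x z
  have hinfeas : 0 ≤ infeas g x := norm_nonneg _
  refine abs_sub_le_iff.2 ⟨?_, ?_⟩
  · have hPsi := le_Psi (g := g) (w := 0) hl x z fun _ => le_rfl
    have hF := sub_optVal_le_T f g C l x z
    simp only [PiLp.zero_apply, zero_mul, Finset.sum_const_zero, zero_add, sub_zero,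
      sub_div] at hPsi
    have hmult : 0 ≤ ‖multiplier g l x z‖ ^ 2 / (2 * l) := by positivity
    have hprod : 0 ≤ ‖zs‖ * infeas g x := by positivity
    rw [F] at hF
    linarith
  · have hsum : ∑ i, zs i * g i x ≤ ‖zs‖ * infeas g x := by
      refine le_trans ?_ (real_inner_le_norm _ _)
      rw [PiLp.inner_apply]
      refine Finset.sum_le_sum fun i _ => ?_
      rw [RCLike.inner_apply, conj_trivial, mul_comm]
      exact mul_le_mul_of_nonneg_right (le_max_left _ _) (hd.nonneg i)
    have hsq : 0 ≤ ‖z‖ ^ 2 / (2 * l) := by positivity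
    linarith [hd.optVal_le x hx]

end IsDualOptimal

end Duality

section UniformConvexity

variable {n : ℕ} {C : Set (E n)} {ν q μ : ℝ}

namespace UniformlyConvexSet

theorem exponent_mem (hC : UniformlyConvexSet ν q C) (hμ : μ = 1 - 2 / q) :
    μ ∈ Set.Ico (0 : ℝ) 1 := by
  have hq := two_pos.trans_le hC.q_ge
  rw [hμ]
  exact ⟨sub_nonneg.2 ((div_le_one hq).2 hC.q_ge), sub_lt_self 1 (by positivity)⟩

theorem le_inner_sub (hC : UniformlyConvexSet ν q C) {u v x : E n} (hv : v ∈ lmo C u)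
    (hx : x ∈ C) : ν / 2 * ‖u‖ * ‖v - x‖ ^ q ≤ inner ℝ u (x - v) := by
  rcases eq_or_ne u 0 with rfl | hu
  · simp
  have hu' : ‖u‖ ≠ 0 := norm_ne_zero_iff.2 hu
  have hw : ‖-(‖u‖⁻¹ • u)‖ = 1 := by
    rw [norm_neg, norm_smul, norm_inv, norm_norm, inv_mul_cancel₀ hu']
  have h := hv.2 _ (hC.mem v hv.1 x hx (1 / 2) (by norm_num) (by norm_num) _ hw)
  simp only [inner_add_right, real_inner_smul_right, inner_neg_right,
    real_inner_self_eq_norm_sq] at h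
  have hnorm : ‖u‖⁻¹ * ‖u‖ ^ 2 = ‖u‖ := by field_simp
  rw [hnorm] at h
  rw [inner_sub_right]
  linarith

theorem norm_sub_sq_le (hC : UniformlyConvexSet ν q C) (hμ : μ = 1 - 2 / q) {ζ : ℝ} (hζ : 0 < ζ)
    {u v x : E n} (hu : ζ ≤ ‖u‖) (hv : v ∈ lmo C u) (hx : x ∈ C) :
    ‖v - x‖ ^ 2 ≤ (2 / (ν * ζ)) ^ (1 - μ) * inner ℝ u (x - v) ^ (1 - μ) := by
  have hq : 0 < q := two_pos.trans_le hC.q_ge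
  have hν := hC.nu_pos
  have hgap : 0 ≤ inner ℝ u (x - v) := by
    rw [inner_sub_right]
    exact sub_nonneg.2 (hv.2 x hx)
  have hpow : ‖v - x‖ ^ q ≤ 2 / (ν * ζ) * inner ℝ u (x - v) := by
    have h := hC.le_inner_sub hv hx
    have hle : ν / 2 * ζ * ‖v - x‖ ^ q ≤ inner ℝ u (x - v) := by
      refine le_trans ?_ h
      gcongr
    rw [← le_div_iff₀' (by positivity)] at hle
    refine hle.trans_eq ?_
    field_simp
  calc ‖v - x‖ ^ 2 = (‖v - x‖ ^ q) ^ (1 - μ) := by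
        rw [← Real.rpow_mul (norm_nonneg _), ← Real.rpow_two, hμ]
        congr 1
        field_simp
        ring
    _ ≤ (2 / (ν * ζ) * inner ℝ u (x - v)) ^ (1 - μ) := by
        have h1μ : 0 ≤ 1 - μ := sub_nonneg.2 (hC.exponent_mem hμ).2.le
        gcongr
    _ = _ := Real.mul_rpow (by positivity) hgap

end UniformlyConvexSet

end UniformConvexity

section ShortStep

variable {n m : ℕ} {f : E n → ℝ} {g : Fin m → E n → ℝ} {C : Set (E n)} {Lf : ℝ}
  {Lg B : Fin m → ℝ} {l : ℝ} {x v : E n} {z : E m}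

-- The case distinction in `shortStep` agrees with the junk value `0 / 0 = 0`.
theorem shortStep_eq_min (f : E n → ℝ) (g : Fin m → E n → ℝ) (Lf : ℝ) (Lg B : Fin m → ℝ) (l : ℝ)
    (x : E n) (z : E m) (v : E n) : shortStep f g Lf Lg B l x z v =
      min 1 (gap f g l x z v / ((LPsi g Lg B l x z + Lf) * ‖v - x‖ ^ 2)) := by
  unfold shortStep
  split_ifs with h
  · rw [h.1, zero_div, min_eq_right zero_le_one]
  · rfl

theorem gap_nonneg (hx : x ∈ C) (hv : v ∈ lmo C (gradF f g l x z)) : 0 ≤ gap f g l x z v := by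
  rw [gap, inner_sub_right]
  exact sub_nonneg.2 (hv.2 x hx)

theorem min_one_rpow_div_le_shortStep (hK : 0 < LPsi g Lg B l x z + Lf) {t μ A L : ℝ}
    (ht : 0 < t) (htG : t ≤ gap f g l x z v) (hμ : 0 ≤ μ)
    (hA : ‖v - x‖ ^ 2 ≤ A * gap f g l x z v ^ (1 - μ)) (hL : (LPsi g Lg B l x z + Lf) * A ≤ L) :
    min 1 (t ^ μ / L) ≤ shortStep f g Lf Lg B l x z v := by
  have hG : 0 < gap f g l x z v := ht.trans_le htG
  have hvx : 0 < ‖v - x‖ := by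
    refine norm_sub_pos_iff.2 fun h => hG.ne' ?_
    rw [gap, h, sub_self, inner_zero_right]
  have hApos : 0 < A := pos_of_mul_pos_left ((pow_pos hvx 2).trans_le hA) (by positivity)
  have hLpos : 0 < L := (mul_pos hK hApos).trans_le hL
  rw [shortStep_eq_min]
  refine min_le_min_left 1 ((div_le_div_iff₀ hLpos (by positivity)).2 ?_)
  set G := gap f g l x z v
  set K := LPsi g Lg B l x z + Lf
  calc t ^ μ * (K * ‖v - x‖ ^ 2)
      ≤ G ^ μ * (K * (A * G ^ (1 - μ))) := by gcongr
    _ = K * A * (G ^ μ * G ^ (1 - μ)) := by ring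
    _ ≤ L * (G ^ μ * G ^ (1 - μ)) := by gcongr
    _ = G * L := by rw [← Real.rpow_add hG, add_sub_cancel, Real.rpow_one, mul_comm]

namespace SmoothConvexProblem

theorem shortStep_mem_Icc (hP : SmoothConvexProblem f g C Lf Lg B) (hl : 0 < l) (hx : x ∈ C)
    (hv : v ∈ lmo C (gradF f g l x z)) :
    shortStep f g Lf Lg B l x z v ∈ Set.Icc (0 : ℝ) 1 := by
  rw [shortStep_eq_min]
  exact ⟨le_min zero_le_one (div_nonneg (gap_nonneg hx hv)
    (mul_nonneg (hP.LPsi_add_pos hl x z).le (sq_nonneg _))), min_le_left _ _⟩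

theorem add_shortStep_smul_mem (hP : SmoothConvexProblem f g C Lf Lg B) (hl : 0 < l)
    (hx : x ∈ C) (hv : v ∈ lmo C (gradF f g l x z)) :
    x + shortStep f g Lf Lg B l x z v • (v - x) ∈ C :=
  hP.f_convex.1.add_smul_sub_mem hx hv.1 (hP.shortStep_mem_Icc hl hx hv)

theorem F_shortStep_le (hP : SmoothConvexProblem f g C Lf Lg B) (hl : 0 < l) (hx : x ∈ C)
    (hv : v ∈ lmo C (gradF f g l x z)) :
    F f g l (x + shortStep f g Lf Lg B l x z v • (v - x)) z ≤
      F f g l x z - shortStep f g Lf Lg B l x z v / 2 * gap f g l x z v := by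
  have hdescent := hP.F_le_add_inner_gradF_add_sq hl hx (hP.add_shortStep_smul_mem hl hx hv) z
  have hs := (hP.shortStep_mem_Icc hl hx hv).1
  have hstep : shortStep f g Lf Lg B l x z v *
      ((LPsi g Lg B l x z + Lf) * ‖v - x‖ ^ 2) ≤ gap f g l x z v :=
    mul_le_of_le_div₀ (gap_nonneg hx hv)
      (mul_nonneg (hP.LPsi_add_pos hl x z).le (sq_nonneg _))
      ((shortStep_eq_min ..).trans_le (min_le_right _ _))
  have hgap : inner ℝ (gradF f g l x z) (v - x) = -gap f g l x z v := by
    rw [gap, ← inner_neg_right, neg_sub]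
  rw [add_sub_cancel_left, real_inner_smul_right, norm_smul, Real.norm_of_nonneg hs,
    hgap] at hdescent
  linarith [mul_le_mul_of_nonneg_left hstep hs]

theorem T_shortStep_le (hP : SmoothConvexProblem f g C Lf Lg B)
    (hne : (feasible g C).Nonempty) (hl : 0 < l) (hx : x ∈ C)
    (hv : v ∈ lmo C (gradF f g l x z)) {μ A L : ℝ} (hμ : 0 ≤ μ)
    (hA : ‖v - x‖ ^ 2 ≤ A * gap f g l x z v ^ (1 - μ)) (hL : (LPsi g Lg B l x z + Lf) * A ≤ L) :
    T f g C l (x + shortStep f g Lf Lg B l x z v • (v - x)) z ≤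
      T f g C l x z - 1 / 2 * min 1 (T f g C l x z ^ μ / L) * T f g C l x z := by
  have hT := T_nonneg f g C l x z
  have hTgap : T f g C l x z ≤ gap f g l x z v :=
    max_le (hP.sub_optVal_le_gap hne hl hx z hv) (gap_nonneg hx hv)
  have hs := hP.shortStep_mem_Icc hl hx hv
  have hmin : min 1 (T f g C l x z ^ μ / L) * T f g C l x z ≤
      shortStep f g Lf Lg B l x z v * T f g C l x z := by
    rcases hT.eq_or_lt with h | h
    · rw [← h, mul_zero, mul_zero]
    · exact mul_le_mul_of_nonneg_right (min_one_rpow_div_le_shortStep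
        (hP.LPsi_add_pos hl x z) h hTgap hμ hA hL) hT
  have hdecrease := hP.F_shortStep_le hl hx hv
  have hF := sub_optVal_le_T f g C l x z
  have hsT := mul_le_mul_of_nonneg_left hTgap hs.1
  have hT1 := mul_le_mul_of_nonneg_right hs.2 hT
  exact max_le (by linarith) (by linarith)

end SmoothConvexProblem

end ShortStep

section MaxIsBigO

variable {ι : Type*} {l : Filter ι} {u v w : ι → ℝ}

theorem isBigO_max_left (hu : ∀ k, 0 ≤ u k) : u =O[l] fun k => max (u k) (v k) :=
  IsBigO.of_norm_le fun k => (Real.norm_of_nonneg (hu k)).trans_le (le_max_left _ _)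

theorem isBigO_max_right (hv : ∀ k, 0 ≤ v k) : v =O[l] fun k => max (u k) (v k) :=
  IsBigO.of_norm_le fun k => (Real.norm_of_nonneg (hv k)).trans_le (le_max_right _ _)

theorem isBigO_max (hu : u =O[l] w) (hv : v =O[l] w) : (fun k => max (u k) (v k)) =O[l] w :=
  (IsBigO.of_norm_le fun _ => abs_max_le_max_abs_abs.trans
    (max_le_add_of_nonneg (abs_nonneg _) (abs_nonneg _))).trans (hu.norm_left.add hv.norm_left)

end MaxIsBigO

section Recursion

theorem exists_eventually_le_of_succ_le_max {w : ℕ → ℝ} {K : ℝ}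
    (h : ∀ᶠ k in atTop, w (k + 1) ≤ max (w k) K) : ∃ M : ℝ, ∀ᶠ k in atTop, w k ≤ M := by
  obtain ⟨N, hN⟩ := eventually_atTop.1 h
  refine ⟨max (w N) K, eventually_atTop.2 ⟨N, fun k hk => ?_⟩⟩
  induction k, hk using Nat.le_induction with
  | base => exact le_max_left _ _
  | succ k hk ih => exact (hN k hk).trans (max_le ih (le_max_right _ _))

theorem add_one_rpow_le {κ r : ℝ} (hκ : 0 < κ) (hr1 : r ≤ 1) :
    (κ + 1) ^ r ≤ (1 + 1 / κ) * κ ^ r := by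
  have hbase : 1 ≤ 1 + 1 / κ := le_add_of_nonneg_right (by positivity)
  calc (κ + 1) ^ r = (1 + 1 / κ) ^ r * κ ^ r := by
        rw [← Real.mul_rpow (by positivity) hκ.le, one_add_mul, one_div_mul_cancel hκ.ne']
    _ ≤ (1 + 1 / κ) * κ ^ r := by
        gcongr
        exact (Real.rpow_le_rpow_of_exponent_le hbase hr1).trans_eq (Real.rpow_one _)

variable {κ μ τ r a A M m t t' : ℝ}

theorem rpow_mul_succ_le (hκ : 1 ≤ κ) (hr1 : r ≤ 1) (hrμ : r * (1 + μ) ≤ 1)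
    (ha : 0 ≤ a) (hA : 0 ≤ A) (ht : 0 ≤ t) (hm : m ≤ 1)
    (h : t' ≤ (1 + a / κ) * (t - 1 / 2 * m * t) + A * κ ^ (-(1 + τ))) :
    (κ + 1) ^ r * t' ≤
      (1 + (1 + 2 * a) / κ) * ((1 - m / 2) * (κ ^ r * t)) + 2 * A * κ ^ (-(r * μ + τ)) := by
  have hκ0 : 0 < κ := one_pos.trans_le hκ
  have hinv : 1 / κ ≤ 1 := (div_le_one hκ0).2 hκ
  have hfactor : (1 + 1 / κ) * (1 + a / κ) ≤ 1 + (1 + 2 * a) / κ := by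
    have e : 1 + (1 + 2 * a) / κ - (1 + 1 / κ) * (1 + a / κ) = a / κ * (1 - 1 / κ) := by
      field_simp
      ring
    rw [← sub_nonneg, e]
    exact mul_nonneg (by positivity) (sub_nonneg.2 hinv)
  have hpow : κ ^ r * κ ^ (-(1 + τ)) ≤ κ ^ (-(r * μ + τ)) := by
    rw [← Real.rpow_add hκ0]
    exact Real.rpow_le_rpow_of_exponent_le hκ (by linarith)
  have hrest : 0 ≤ 1 - m / 2 := by linarith
  calc (κ + 1) ^ r * t'
      ≤ (κ + 1) ^ r * ((1 + a / κ) * ((1 - m / 2) * t) + A * κ ^ (-(1 + τ))) := by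
        gcongr
        linarith
    _ ≤ (1 + 1 / κ) * κ ^ r * ((1 + a / κ) * ((1 - m / 2) * t) + A * κ ^ (-(1 + τ))) := by
        gcongr
        exact add_one_rpow_le hκ0 hr1
    _ = (1 + 1 / κ) * (1 + a / κ) * ((1 - m / 2) * (κ ^ r * t))
          + (1 + 1 / κ) * A * (κ ^ r * κ ^ (-(1 + τ))) := by ring
    _ ≤ (1 + (1 + 2 * a) / κ) * ((1 - m / 2) * (κ ^ r * t)) + 2 * A * κ ^ (-(r * μ + τ)) := by
        gcongr
        linarith

theorem rpow_neg_div_le_min {L : ℝ} (hκ : 1 ≤ κ) (hμ : 0 ≤ μ) (hs : 0 ≤ r * μ + τ) (hM : 1 ≤ M)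
    (hL : 0 < L) (hLM : L ≤ M * κ ^ τ) (ht : 1 ≤ κ ^ r * t) :
    κ ^ (-(r * μ + τ)) / M ≤ min 1 (t ^ μ / L) := by
  have hκ0 : 0 < κ := one_pos.trans_le hκ
  have hM0 : 0 < M := one_pos.trans_le hM
  refine le_min ((div_le_one hM0).2
    ((Real.rpow_le_one_of_one_le_of_nonpos hκ (neg_nonpos.2 hs)).trans hM)) ?_
  have hrt : κ ^ (-r) ≤ t := by
    rw [Real.rpow_neg hκ0.le]
    exact (inv_le_iff_one_le_mul₀' (by positivity)).2 ht
  have ht0 : 0 ≤ t := le_trans (by positivity) hrt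
  calc κ ^ (-(r * μ + τ)) / M = (κ ^ (-r)) ^ μ / (M * κ ^ τ) := by
        rw [neg_add, Real.rpow_add hκ0, ← Real.rpow_mul hκ0.le, neg_mul, Real.rpow_neg hκ0.le τ]
        field_simp
    _ ≤ t ^ μ / L := by gcongr

theorem rpow_mul_succ_le_max {L : ℝ} (hκ : 1 ≤ κ) (hμ : 0 ≤ μ) (hτ : 0 ≤ τ) (hr0 : 0 ≤ r)
    (hr1 : r ≤ 1) (hrμ : r * (1 + μ) ≤ 1) (ha : 0 ≤ a) (hA : 0 ≤ A) (hM : 1 ≤ M) (hL : 0 < L)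
    (hLM : L ≤ M * κ ^ τ) (hsmall : (1 + 2 * a) / κ ≤ κ ^ (-(r * μ + τ)) / M / 4) (ht : 0 ≤ t)
    (h : t' ≤ (1 + a / κ) * (t - 1 / 2 * min 1 (t ^ μ / L) * t) + A * κ ^ (-(1 + τ))) :
    (κ + 1) ^ r * t' ≤ max (κ ^ r * t) (2 + 2 * a + 8 * A * M) := by
  have _ : 0 < κ := one_pos.trans_le hκ
  have hs : 0 ≤ r * μ + τ := by positivity
  have hstep := rpow_mul_succ_le hκ hr1 hrμ ha hA ht (min_le_left 1 (t ^ μ / L)) h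
  have hm : 0 ≤ min 1 (t ^ μ / L) := by positivity
  have hw : 0 ≤ κ ^ r * t := by positivity
  have hdecrease : 0 ≤ (1 - min 1 (t ^ μ / L) / 2) * (κ ^ r * t) :=
    mul_nonneg (by linarith [min_le_left 1 (t ^ μ / L)]) hw
  have hAM : A ≤ A * M := le_mul_of_one_le_right hA hM
  have hpow : κ ^ (-(r * μ + τ)) ≤ 1 :=
    Real.rpow_le_one_of_one_le_of_nonpos hκ (neg_nonpos.2 hs)
  set m := min 1 (t ^ μ / L)
  set w := κ ^ r * t
  rcases le_total w 1 with hw1 | hw1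
  · refine hstep.trans (le_max_of_le_right ?_)
    have hone : (1 - m / 2) * w ≤ 1 := mul_le_one₀ (by linarith) hw hw1
    have hdiv : (1 + 2 * a) / κ ≤ 1 + 2 * a := div_le_self (by positivity) hκ
    calc (1 + (1 + 2 * a) / κ) * ((1 - m / 2) * w) + 2 * A * κ ^ (-(r * μ + τ))
        ≤ (1 + (1 + 2 * a)) * 1 + 2 * A * 1 := by gcongr
      _ ≤ 2 + 2 * a + 8 * A * M := by linarith
  · -- the right-hand side is a convex combination of `w` and `8 * A * M`
    have hθ : κ ^ (-(r * μ + τ)) / M ≤ m := rpow_neg_div_le_min hκ hμ hs hM hL hLM hw1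
    have hpow_eq : κ ^ (-(r * μ + τ)) = κ ^ (-(r * μ + τ)) / M * M :=
      (div_mul_cancel₀ _ (by positivity)).symm
    have hθ0 : 0 ≤ κ ^ (-(r * μ + τ)) / M := by positivity
    have hθ1 : κ ^ (-(r * μ + τ)) / M ≤ 1 := hθ.trans (min_le_left _ _)
    rw [hpow_eq] at hstep
    set θ := κ ^ (-(r * μ + τ)) / M
    calc (κ + 1) ^ r * t'
        ≤ (1 + θ / 4) * ((1 - θ / 2) * w) + 2 * A * (θ * M) := by
          refine hstep.trans ?_
          gcongr ?_ * ((1 - ?_ / 2) * w) + _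
          linarith
      _ ≤ (1 - θ / 4) * w + θ / 4 * (8 * A * M) := by
          linarith [mul_nonneg (sq_nonneg θ) hw]
      _ ≤ max w (8 * A * M) := by
          refine (add_le_add (mul_le_mul_of_nonneg_left (le_max_left w (8 * A * M))
            (by linarith)) (mul_le_mul_of_nonneg_left (le_max_right w (8 * A * M))
            (by positivity))).trans_eq (by ring)
      _ ≤ max w (2 + 2 * a + 8 * A * M) := max_le_max_left _ (by linarith)

theorem eventually_div_le_rpow_neg {s b c : ℝ} (hs : s < 1) (hc : 0 < c) :
    ∀ᶠ k : ℕ in atTop, b / k ≤ c * (k : ℝ) ^ (-s) := by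
  have hlim : Tendsto (fun k : ℕ => (k : ℝ) ^ (1 - s)) atTop atTop :=
    (tendsto_rpow_atTop (sub_pos.2 hs)).comp tendsto_natCast_atTop_atTop
  filter_upwards [hlim.eventually_ge_atTop (b / c), eventually_gt_atTop 0] with k hk hk0
  have hk0' : (0 : ℝ) < k := Nat.cast_pos.2 hk0
  rw [div_le_iff₀ hk0', mul_assoc, ← Real.rpow_add_one hk0'.ne', neg_add_eq_sub]
  exact (div_le_iff₀' hc).1 hk

theorem isBigO_rpow_of_recursion {T η δ L : ℕ → ℝ} (hμ : 0 ≤ μ) (hτ : 0 ≤ τ) (hr0 : 0 ≤ r)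
    (hr1 : r ≤ 1) (hrμ : r * (1 + μ) ≤ 1) (hs : r * μ + τ < 1) (hT : ∀ k, 0 ≤ T k)
    (hL : ∀ k, 0 < L k) (hL' : L =O[atTop] fun k : ℕ => (k : ℝ) ^ τ)
    (hη : η =O[atTop] fun k : ℕ => (k : ℝ)⁻¹)
    (hδ : δ =O[atTop] fun k : ℕ => (k : ℝ) ^ (-(1 + τ)))
    (h : ∀ᶠ k in atTop, T (k + 1) ≤
      (1 + η k) * (T k - 1 / 2 * min 1 (T k ^ μ / L k) * T k) + δ k) :
    T =O[atTop] fun k : ℕ => (k : ℝ) ^ (-r) := by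
  obtain ⟨M, hM, hLM⟩ := hL'.exists_pos
  obtain ⟨a, ha, hηa⟩ := hη.exists_pos
  obtain ⟨A, hA, hδA⟩ := hδ.exists_pos
  have hsucc : ∀ᶠ k : ℕ in atTop, ((k + 1 : ℕ) : ℝ) ^ r * T (k + 1) ≤
      max ((k : ℝ) ^ r * T k) (2 + 2 * a + 8 * A * max M 1) := by
    filter_upwards [h, hLM.bound, hηa.bound, hδA.bound, eventually_ge_atTop 1,
      eventually_div_le_rpow_neg (b := 1 + 2 * a) (c := (4 * max M 1)⁻¹) hs (by positivity)]
      with k hk hLk hηk hδk hk1 hsmall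
    have hk1' : (1 : ℝ) ≤ k := Nat.one_le_cast.2 hk1
    rw [Real.norm_of_nonneg (by positivity : (0 : ℝ) ≤ (k : ℝ) ^ τ)] at hLk
    rw [Real.norm_of_nonneg (by positivity : (0 : ℝ) ≤ (k : ℝ) ^ (-(1 + τ)))] at hδk
    rw [Real.norm_of_nonneg (by positivity : (0 : ℝ) ≤ (k : ℝ)⁻¹), ← div_eq_mul_inv] at hηk
    have hdecrease : 0 ≤ T k - 1 / 2 * min 1 (T k ^ μ / L k) * T k := by
      linarith [mul_le_of_le_one_left (hT k) (min_le_left 1 (T k ^ μ / L k)), hT k]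
    rw [Nat.cast_add_one]
    refine rpow_mul_succ_le_max hk1' hμ hτ hr0 hr1 hrμ ha.le hA.le (le_max_right M 1) (hL k)
      ((le_of_abs_le hLk).trans (by gcongr; exact le_max_left M 1))
      (hsmall.trans_eq (by field_simp)) (hT k) (hk.trans ?_)
    gcongr
    exacts [le_of_abs_le hηk, le_of_abs_le hδk]
  obtain ⟨K, hK⟩ := exists_eventually_le_of_succ_le_max
    (w := fun k : ℕ => (k : ℝ) ^ r * T k) hsucc
  refine IsBigO.of_bound K ?_
  filter_upwards [hK, eventually_gt_atTop 0] with k hk hk0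
  have hk0' : (0 : ℝ) < k := Nat.cast_pos.2 hk0
  rw [Real.norm_of_nonneg (hT k), Real.norm_of_nonneg (by positivity), Real.rpow_neg hk0'.le,
    ← div_eq_mul_inv, le_div_iff₀' (by positivity)]
  exact hk

theorem rpow_neg_min_le (k : ℕ) (a b : ℝ) :
    (k : ℝ) ^ (-min a b) ≤ max ((k : ℝ) ^ (-a)) ((k : ℝ) ^ (-b)) := by
  rcases min_choice a b with h | h <;> rw [h]
  exacts [le_max_left _ _, le_max_right _ _]

theorem isBigO_natCast_rpow_of_le {a b : ℝ} (h : a ≤ b) :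
    (fun k : ℕ => (k : ℝ) ^ a) =O[atTop] fun k : ℕ => (k : ℝ) ^ b := by
  refine IsBigO.of_norm_eventuallyLE ?_
  filter_upwards [eventually_ge_atTop 1] with k hk
  rw [Real.norm_of_nonneg (by positivity)]
  exact Real.rpow_le_rpow_of_exponent_le (Nat.one_le_cast.2 hk) h

end Recursion

/-- The growth conditions on the penalty parameters `lam` and the dual stepsizes `σ` that enter the
rates. -/
structure PenaltySchedule (τ : ℝ) (lam σ : ℕ → ℝ) : Prop where
  tau_mem : τ ∈ Set.Ioo (0 : ℝ) 1
  lam_theta : lam =Θ[atTop] fun k : ℕ => (k : ℝ) ^ τ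
  lam_diff : (fun k : ℕ => lam (k + 1) - lam k) =O[atTop] fun k : ℕ => (k : ℝ) ^ (-(1 - τ))
  sigma_summable : Summable σ
  sigma_isBigO : σ =O[atTop] fun k : ℕ => (k : ℝ) ^ (-(1 - τ))

/-- The coefficient of `‖max {-z / λ, g(x)}‖²` in the increase of the augmented Lagrangian caused by
the updates of the dual variable and of the penalty parameter (see `T_dual_update_le`). -/
noncomputable def dualGrowth (lam σ : ℕ → ℝ) (k : ℕ) : ℝ := σ k + (lam (k + 1) - lam k) / 2

namespace PenaltySchedule

variable {τ : ℝ} {lam σ : ℕ → ℝ}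

theorem inv_lam_isBigO (hS : PenaltySchedule τ lam σ) :
    (fun k => (lam k)⁻¹) =O[atTop] fun k : ℕ => (k : ℝ) ^ (-τ) :=
  hS.lam_theta.inv.1.congr_right fun k => (Real.rpow_neg k.cast_nonneg τ).symm

theorem dualGrowth_div_isBigO (hS : PenaltySchedule τ lam σ) :
    (fun k => dualGrowth lam σ k / lam k) =O[atTop] fun k : ℕ => (k : ℝ)⁻¹ := by
  have hgrowth : dualGrowth lam σ =O[atTop] fun k : ℕ => (k : ℝ) ^ (-(1 - τ)) :=
    hS.sigma_isBigO.add ((hS.lam_diff.const_mul_left 2⁻¹).congr_left fun k => by ring)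
  refine (hgrowth.mul hS.inv_lam_isBigO).congr' (Eventually.of_forall fun k => ?_) ?_
  · exact (div_eq_mul_inv _ _).symm
  · filter_upwards [eventually_gt_atTop 0] with k hk
    rw [← Real.rpow_add (Nat.cast_pos.2 hk), ← Real.rpow_neg_one]
    congr 1
    ring

theorem dualGrowth_div_sq_isBigO (hS : PenaltySchedule τ lam σ) :
    (fun k => dualGrowth lam σ k / lam k ^ 2) =O[atTop] fun k : ℕ => (k : ℝ) ^ (-(1 + τ)) := by
  refine (hS.dualGrowth_div_isBigO.mul hS.inv_lam_isBigO).congr'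
    (Eventually.of_forall fun k => ?_) ?_
  · exact (div_eq_mul_inv _ _).symm.trans (by rw [div_div, ← sq])
  · filter_upwards [eventually_gt_atTop 0] with k hk
    rw [← Real.rpow_neg_one, ← Real.rpow_add (Nat.cast_pos.2 hk)]
    congr 1
    ring

theorem tendsto_inv_lam (hS : PenaltySchedule τ lam σ) :
    Tendsto (fun k => (lam k)⁻¹) atTop (nhds 0) :=
  hS.inv_lam_isBigO.trans_tendsto
    ((tendsto_rpow_neg_atTop hS.tau_mem.1).comp tendsto_natCast_atTop_atTop)

end PenaltySchedule

/-- A run of the single-loop conditional-gradient augmented-Lagrangian method with the short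
stepsize, penalty parameters `lam` and dual stepsizes `σ`. -/
structure IsShortStepRun {n m : ℕ} (f : E n → ℝ) (g : Fin m → E n → ℝ) (C : Set (E n)) (Lf : ℝ)
    (Lg B : Fin m → ℝ) (lam σ : ℕ → ℝ) (x : ℕ → E n) (z : ℕ → E m) (v : ℕ → E n) : Prop where
  x_zero : x 0 ∈ C
  z_zero : ∀ i, 0 ≤ z 0 i
  lam_pos : ∀ k, 0 < lam k
  lam_mono : Monotone lam
  sigma_nonneg : ∀ k, 0 ≤ σ k
  sigma_le : ∀ k, σ k ≤ lam k
  v_mem : ∀ k, v k ∈ lmo C (gradF f g (lam k) (x k) (z k))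
  x_succ : ∀ k, x (k + 1) = x k + shortStep f g Lf Lg B (lam k) (x k) (z k) (v k) • (v k - x k)
  z_succ : ∀ k, z (k + 1) = z k + σ k • dualDirection g (lam k) (x (k + 1)) (z k)

theorem exists_forall_le_of_succ_le_add {w s : ℕ → ℝ} (hs0 : ∀ k, 0 ≤ s k) (hs : Summable s)
    (h : ∀ k, w (k + 1) ≤ w k + s k) : ∃ K, ∀ k, w k ≤ K := by
  have hsum (k : ℕ) : w k ≤ w 0 + ∑ j ∈ Finset.range k, s j := by
    induction k with
    | zero => simp
    | succ k ih =>
      rw [Finset.sum_range_succ]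
      linarith [h k]
  exact ⟨w 0 + ∑' j, s j, fun k => (hsum k).trans
    (add_le_add_right (hs.sum_le_tsum _ fun j _ => hs0 j) _)⟩

namespace IsShortStepRun

variable {n m : ℕ} {f : E n → ℝ} {g : Fin m → E n → ℝ} {C : Set (E n)} {Lf : ℝ}
  {Lg B : Fin m → ℝ} {lam σ : ℕ → ℝ} {x : ℕ → E n} {z : ℕ → E m} {v : ℕ → E n} {zs : E m}
  {τ : ℝ}

theorem x_mem (hR : IsShortStepRun f g C Lf Lg B lam σ x z v)
    (hP : SmoothConvexProblem f g C Lf Lg B) (k : ℕ) : x k ∈ C := by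
  induction k with
  | zero => exact hR.x_zero
  | succ k ih =>
    rw [hR.x_succ]
    exact hP.add_shortStep_smul_mem (hR.lam_pos k) ih (hR.v_mem k)

theorem z_nonneg (hR : IsShortStepRun f g C Lf Lg B lam σ x z v) (k : ℕ) (i : Fin m) :
    0 ≤ z k i := by
  induction k with
  | zero => exact hR.z_zero i
  | succ k ih =>
    have hratio : σ k * (z k i / lam k) ≤ z k i := by
      rw [mul_div_assoc', div_le_iff₀ (hR.lam_pos k), mul_comm]
      exact mul_le_mul_of_nonneg_left (hR.sigma_le k) ih
    have hdir : σ k * -(z k i / lam k) ≤ σ k * max (-(z k i / lam k)) (g i (x (k + 1))) :=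
      mul_le_mul_of_nonneg_left (le_max_left _ _) (hR.sigma_nonneg k)
    rw [hR.z_succ]
    change 0 ≤ z k i + σ k * max (-(z k i / lam k)) (g i (x (k + 1)))
    linarith

theorem exists_norm_z_le (hR : IsShortStepRun f g C Lf Lg B lam σ x z v)
    (hP : SmoothConvexProblem f g C Lf Lg B) (hC : Bornology.IsBounded C) (hσ : Summable σ) :
    ∃ D, ∀ k, ‖z k‖ ≤ D := by
  obtain ⟨M, hM⟩ := hP.bddAbove_g hC
  have hcoord (i : Fin m) : ∃ K, ∀ k, z k i ≤ K := by
    refine exists_forall_le_of_succ_le_add (s := fun k => σ k * max 0 M)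
      (fun k => mul_nonneg (hR.sigma_nonneg k) (le_max_left _ _)) (hσ.mul_right _) fun k => ?_
    rw [hR.z_succ]
    refine add_le_add_right (mul_le_mul_of_nonneg_left (max_le_max ?_ ?_) (hR.sigma_nonneg k)) _
    · exact neg_nonpos.2 (div_nonneg (hR.z_nonneg k i) (hR.lam_pos k).le)
    · exact hM _ (hR.x_mem hP _) i
  choose K hK using hcoord
  refine ⟨√(∑ i, K i ^ 2), fun k => Real.le_sqrt_of_sq_le ?_⟩
  rw [EuclideanSpace.real_norm_sq_eq]
  exact Finset.sum_le_sum fun i _ => pow_le_pow_left₀ (hR.z_nonneg k i) (hK i k) 2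

theorem LPsi_add_isBigO (hR : IsShortStepRun f g C Lf Lg B lam σ x z v)
    (hP : SmoothConvexProblem f g C Lf Lg B) (hC : Bornology.IsBounded C) (hσ : Summable σ) :
    (fun k => LPsi g Lg B (lam k) (x k) (z k) + Lf) =O[atTop] lam := by
  obtain ⟨M, hM⟩ := hP.bddAbove_g hC
  obtain ⟨D, hD⟩ := hR.exists_norm_z_le hP hC hσ
  have hone : (fun _ : ℕ => (1 : ℝ)) =O[atTop] lam := by
    refine IsBigO.of_bound (lam 0)⁻¹ (Eventually.of_forall fun k => ?_)
    rw [norm_one, Real.norm_of_nonneg (hR.lam_pos k).le]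
    exact (one_le_inv_mul₀ (hR.lam_pos 0)).2 (hR.lam_mono k.zero_le)
  have hmult (i : Fin m) : (fun k => max (lam k * g i (x k) + z k i) 0) =O[atTop] lam := by
    refine IsBigO.trans (isBigO_of_le _ fun k => ?_)
      (((isBigO_refl lam atTop).const_mul_left |M|).add (hone.const_mul_left |D|))
    have hl := (hR.lam_pos k).le
    rw [Real.norm_of_nonneg (le_max_right _ _), Real.norm_of_nonneg (by positivity)]
    refine max_le ?_ (by positivity)
    have hg := mul_le_mul_of_nonneg_left ((hM _ (hR.x_mem hP k) i).trans (le_abs_self M)) hl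
    have hz := (le_abs_self _).trans ((PiLp.norm_apply_le (z k) i).trans (hD k))
    linarith [le_abs_self D]
  have hLPsi : (fun k => LPsi g Lg B (lam k) (x k) (z k)) =O[atTop] lam :=
    IsBigO.fun_sum fun i _ => (((isBigO_refl lam atTop).const_mul_left (B i ^ 2)).congr_left
      fun k => mul_comm _ _).add ((hmult i).const_mul_left (Lg i))
  exact hLPsi.add ((hone.const_mul_left Lf).congr_left fun _ => mul_one Lf)

theorem T_succ_le (hR : IsShortStepRun f g C Lf Lg B lam σ x z v)
    (hP : SmoothConvexProblem f g C Lf Lg B) (hne : (feasible g C).Nonempty)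
    (hd : IsDualOptimal f g C zs) {μ A D : ℝ} (hμ : 0 ≤ μ) {k : ℕ} (hD : ‖z k - zs‖ ^ 2 ≤ D)
    (hA : ‖v k - x k‖ ^ 2 ≤ A * gap f g (lam k) (x k) (z k) (v k) ^ (1 - μ)) :
    T f g C (lam (k + 1)) (x (k + 1)) (z (k + 1)) ≤
      (1 + 4 * (dualGrowth lam σ k / lam k)) * (T f g C (lam k) (x k) (z k) - 1 / 2 *
        min 1 (T f g C (lam k) (x k) (z k) ^ μ / ((LPsi g Lg B (lam k) (x k) (z k) + Lf) * A)) *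
          T f g C (lam k) (x k) (z k)) + 4 * D * (dualGrowth lam σ k / lam k ^ 2) := by
  have hl := hR.lam_pos k
  have hlmono := hR.lam_mono k.le_succ
  have hxmem := hR.x_mem hP (k + 1)
  have hgrowth : 0 ≤ dualGrowth lam σ k :=
    add_nonneg (hR.sigma_nonneg k) (div_nonneg (sub_nonneg.2 hlmono) two_pos.le)
  have hdual := T_dual_update_le (f := f) (g := g) (C := C) hl hlmono (hR.sigma_nonneg k)
    (x (k + 1)) (z k)
  have hprimal := hP.T_shortStep_le hne hl (hR.x_mem hP k) (hR.v_mem k) hμ hA le_rfl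
  rw [← hR.z_succ, ← dualGrowth] at hdual
  rw [← hR.x_succ] at hprimal
  set t := T f g C (lam k) (x (k + 1)) (z k)
  calc T f g C (lam (k + 1)) (x (k + 1)) (z (k + 1))
      ≤ t + dualGrowth lam σ k * (4 * t / lam k + 4 * ‖z k - zs‖ ^ 2 / lam k ^ 2) := by
        refine hdual.trans (add_le_add_right (mul_le_mul_of_nonneg_left ?_ hgrowth) _)
        exact hd.norm_dualDirection_sq_le hl hxmem (z k)
    _ ≤ t + dualGrowth lam σ k * (4 * t / lam k + 4 * D / lam k ^ 2) := by gcongr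
    _ = (1 + 4 * (dualGrowth lam σ k / lam k)) * t + 4 * D * (dualGrowth lam σ k / lam k ^ 2) := by
        ring
    _ ≤ _ := by gcongr

theorem exists_norm_z_sub_sq_le (hR : IsShortStepRun f g C Lf Lg B lam σ x z v)
    (hP : SmoothConvexProblem f g C Lf Lg B) (hC : Bornology.IsBounded C) (hσ : Summable σ)
    (zs : E m) : ∃ D, ∀ k, ‖z k - zs‖ ^ 2 ≤ D := by
  obtain ⟨D, hD⟩ := hR.exists_norm_z_le hP hC hσ
  exact ⟨(D + ‖zs‖) ^ 2, fun k => pow_le_pow_left₀ (norm_nonneg _)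
    ((norm_sub_le _ _).trans (add_le_add_left (hD k) _)) 2⟩

theorem T_isBigO_rpow (hR : IsShortStepRun f g C Lf Lg B lam σ x z v)
    (hP : SmoothConvexProblem f g C Lf Lg B) (hC : Bornology.IsBounded C)
    (hne : (feasible g C).Nonempty) (hd : IsDualOptimal f g C zs)
    (hS : PenaltySchedule τ lam σ) {μ r A : ℝ} (hμ : 0 ≤ μ) (hr0 : 0 ≤ r) (hr1 : r ≤ 1)
    (hrμ : r * (1 + μ) ≤ 1) (hs : r * μ + τ < 1) (hA0 : 0 < A)
    (hA : ∀ᶠ k in atTop,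
      ‖v k - x k‖ ^ 2 ≤ A * gap f g (lam k) (x k) (z k) (v k) ^ (1 - μ)) :
    (fun k => T f g C (lam k) (x k) (z k)) =O[atTop] fun k : ℕ => (k : ℝ) ^ (-r) := by
  obtain ⟨D, hD⟩ := hR.exists_norm_z_sub_sq_le hP hC hS.sigma_summable zs
  have hL : (fun k => (LPsi g Lg B (lam k) (x k) (z k) + Lf) * A) =O[atTop]
      fun k : ℕ => (k : ℝ) ^ τ :=
    ((((hR.LPsi_add_isBigO hP hC hS.sigma_summable).trans hS.lam_theta.1).const_mul_left
      A).congr_left fun k => mul_comm _ _)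
  refine isBigO_rpow_of_recursion hμ hS.tau_mem.1.le hr0 hr1 hrμ hs
    (fun k => T_nonneg f g C _ _ _)
    (fun k => mul_pos (hP.LPsi_add_pos (hR.lam_pos k) _ _) hA0) hL
    (hS.dualGrowth_div_isBigO.const_mul_left 4)
    (hS.dualGrowth_div_sq_isBigO.const_mul_left (4 * D)) ?_
  filter_upwards [hA] with k hk
  exact hR.T_succ_le hP hne hd hμ (hD k) hk

theorem T_isBigO_one (hR : IsShortStepRun f g C Lf Lg B lam σ x z v)
    (hP : SmoothConvexProblem f g C Lf Lg B) (hC : Bornology.IsBounded C)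
    (hne : (feasible g C).Nonempty) (hd : IsDualOptimal f g C zs)
    (hS : PenaltySchedule τ lam σ) :
    (fun k => T f g C (lam k) (x k) (z k)) =O[atTop] fun _ => (1 : ℝ) := by
  obtain ⟨R, hR0, hdiam⟩ := hC.exists_pos_norm_le
  have hstep (k : ℕ) : ‖v k - x k‖ ^ 2 ≤
      (R + R) ^ 2 * gap f g (lam k) (x k) (z k) (v k) ^ (1 - 1 : ℝ) := by
    rw [sub_self, Real.rpow_zero, mul_one]
    exact pow_le_pow_left₀ (norm_nonneg _) ((norm_sub_le _ _).trans
      (add_le_add (hdiam _ (hR.v_mem k).1) (hdiam _ (hR.x_mem hP k)))) 2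
  simpa only [neg_zero, Real.rpow_zero] using hR.T_isBigO_rpow hP hC hne hd hS zero_le_one le_rfl
    zero_le_one (by norm_num) (by linarith [hS.tau_mem.2]) (by positivity)
    (Eventually.of_forall hstep)

theorem tendsto_norm_dualDirection_sq (hR : IsShortStepRun f g C Lf Lg B lam σ x z v)
    (hP : SmoothConvexProblem f g C Lf Lg B) (hC : Bornology.IsBounded C)
    (hne : (feasible g C).Nonempty) (hd : IsDualOptimal f g C zs)
    (hS : PenaltySchedule τ lam σ) :
    Tendsto (fun k => ‖dualDirection g (lam k) (x k) (z k)‖ ^ 2) atTop (nhds 0) := by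
  obtain ⟨D, hD⟩ := hR.exists_norm_z_sub_sq_le hP hC hS.sigma_summable zs
  have hinv := hS.tendsto_inv_lam
  have hT : Tendsto (fun k => T f g C (lam k) (x k) (z k) * (lam k)⁻¹) atTop (nhds 0) :=
    ((hR.T_isBigO_one hP hC hne hd hS).mul (isBigO_refl _ _)).trans_tendsto (by simpa using hinv)
  have hbound := (hT.const_mul 4).add ((hinv.pow 2).const_mul (4 * D))
  simp only [mul_zero, zero_pow two_ne_zero, add_zero] at hbound
  refine squeeze_zero (fun k => sq_nonneg _) (fun k => ?_) hbound
  refine (hd.norm_dualDirection_sq_le (hR.lam_pos k) (hR.x_mem hP k) (z k)).trans ?_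
  rw [mul_div_assoc, div_eq_mul_inv, div_eq_mul_inv, inv_pow]
  gcongr
  exact hD k

theorem eventually_mem_setA (hR : IsShortStepRun f g C Lf Lg B lam σ x z v)
    (hP : SmoothConvexProblem f g C Lf Lg B) (hC : Bornology.IsBounded C)
    (hne : (feasible g C).Nonempty) (hd : IsDualOptimal f g C zs)
    (hS : PenaltySchedule τ lam σ) {ε : ℝ} (hε : 0 < ε) :
    ∀ᶠ k in atTop, (x k, multiplier g (lam k) (x k) (z k)) ∈ setA g ε := by
  filter_upwards [(hR.tendsto_norm_dualDirection_sq hP hC hne hd hS).eventually_lt_const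
    (pow_pos hε 2)] with k hk
  have hl := hR.lam_pos k
  have hdir (i : Fin m) : |max (-(z k i / lam k)) (g i (x k))| < ε :=
    (PiLp.norm_apply_le (dualDirection g (lam k) (x k) (z k)) i).trans_lt
      (lt_of_pow_lt_pow_left₀ 2 hε.le hk)
  refine ⟨fun i => (le_max_right _ _).trans (lt_of_abs_lt (hdir i)).le,
    multiplier_nonneg _ _, fun i hi => ?_⟩
  have hlt : g i (x k) < -(z k i / lam k) :=
    (lt_max_iff.1 (hi.trans (neg_lt_of_abs_lt (hdir i)))).resolve_right (lt_irrefl _)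
  refine (max_mul_add_zero_eq hl (g i (x k)) (z k i)).trans ?_
  rw [max_eq_left hlt.le, mul_neg, mul_div_cancel₀ _ hl.ne', add_neg_cancel]

theorem exists_eventually_le_norm_gradF (hR : IsShortStepRun f g C Lf Lg B lam σ x z v)
    (hP : SmoothConvexProblem f g C Lf Lg B) (hC : Bornology.IsBounded C)
    (hne : (feasible g C).Nonempty) (hd : IsDualOptimal f g C zs)
    (hS : PenaltySchedule τ lam σ) (haway : LagrangianGradBoundedAway f g C) :
    ∃ ζ > 0, ∀ᶠ k in atTop, ζ ≤ ‖gradF f g (lam k) (x k) (z k)‖ := by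
  obtain ⟨ε, hε, ζ, hζ, hgrad⟩ := haway
  refine ⟨ζ, hζ, ?_⟩
  filter_upwards [hR.eventually_mem_setA hP hC hne hd hS hε] with k hk
  have hx := hR.x_mem hP k
  rw [gradF_eq (hP.f_diff _ hx) (fun i => hP.g_diff i _ hx) (hR.lam_pos k)]
  exact hgrad _ _ hk hx

theorem residual_isBigO (hR : IsShortStepRun f g C Lf Lg B lam σ x z v)
    (hP : SmoothConvexProblem f g C Lf Lg B) (hC : Bornology.IsBounded C)
    (hd : IsDualOptimal f g C zs) (hS : PenaltySchedule τ lam σ) :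
    (fun k => max |f (x k) - optVal f g C| (infeas g (x k))) =O[atTop]
      fun k : ℕ => max (T f g C (lam k) (x k) (z k)) ((k : ℝ) ^ (-τ)) := by
  obtain ⟨D, hD⟩ := hR.exists_norm_z_le hP hC hS.sigma_summable
  set w := fun k : ℕ => max (T f g C (lam k) (x k) (z k)) ((k : ℝ) ^ (-τ))
  have hT : (fun k => T f g C (lam k) (x k) (z k)) =O[atTop] w :=
    isBigO_max_left fun k => T_nonneg f g C _ _ _
  have hinv : (fun k => (lam k)⁻¹) =O[atTop] w :=
    hS.inv_lam_isBigO.trans (isBigO_max_right fun k => by positivity)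
  have hinfeas : (fun k => infeas g (x k)) =O[atTop] w := by
    refine IsBigO.trans (IsBigO.of_norm_le fun k => ?_)
      (hT.add (hinv.const_mul_left (2 * (1 + (D + ‖zs‖)))))
    have hz : ‖z k - zs‖ ≤ D + ‖zs‖ := (norm_sub_le _ _).trans (add_le_add_left (hD k) _)
    have hl := hR.lam_pos k
    refine (Real.norm_of_nonneg (norm_nonneg _)).trans_le ?_
    refine (hd.infeas_le hl (hR.x_mem hP k) (hR.z_nonneg k)).trans ?_
    rw [div_eq_mul_inv]
    gcongr
  have hvalue : (fun k => |f (x k) - optVal f g C|) =O[atTop] w := by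
    refine IsBigO.trans (IsBigO.of_norm_le fun k => ?_)
      ((hT.add (hinv.const_mul_left (D ^ 2 / 2))).add (hinfeas.const_mul_left ‖zs‖))
    have hl := hR.lam_pos k
    refine (Real.norm_of_nonneg (abs_nonneg _)).trans_le ?_
    refine (hd.abs_sub_optVal_le hl (hR.x_mem hP k) (z k)).trans ?_
    rw [← div_div, div_eq_mul_inv _ (lam k)]
    gcongr
    exact hD k
  exact isBigO_max hvalue hinfeas

theorem T_isBigO {ν q μ : ℝ} (hR : IsShortStepRun f g C Lf Lg B lam σ x z v)
    (hP : SmoothConvexProblem f g C Lf Lg B) (hbdd : Bornology.IsBounded C)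
    (hne : (feasible g C).Nonempty) (hd : IsDualOptimal f g C zs) (hS : PenaltySchedule τ lam σ)
    (hC : UniformlyConvexSet ν q C) (haway : LagrangianGradBoundedAway f g C)
    (hμ : μ = 1 - 2 / q) :
    (fun k => T f g C (lam k) (x k) (z k)) =O[atTop] fun k : ℕ =>
      max ((k : ℝ) ^ (-(1 / (1 + μ)))) ((k : ℝ) ^ (-((2 - 2 * τ) / (1 + μ)))) := by
  obtain ⟨ζ, hζ, hgrad⟩ := hR.exists_eventually_le_norm_gradF hP hbdd hne hd hS haway
  have hμ' := hC.exponent_mem hμ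
  have hτ := hS.tau_mem.2
  have hν := hC.nu_pos
  have hμ1 : 0 < 1 + μ := by linarith [hμ'.1]
  set r := min (1 / (1 + μ)) ((2 - 2 * τ) / (1 + μ))
  have hr0 : 0 < r := lt_min (by positivity) (div_pos (by linarith) hμ1)
  have hrμ : r * (1 + μ) ≤ 1 := (le_div_iff₀ hμ1).1 (min_le_left _ _)
  have hr1 : r ≤ 1 := (le_mul_of_one_le_right hr0.le (by linarith [hμ'.1])).trans hrμ
  have hs : r * μ + τ < 1 := by
    have h : r * (1 + μ) ≤ 2 - 2 * τ := (le_div_iff₀ hμ1).1 (min_le_right _ _)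
    linarith [mul_lt_of_lt_one_right hr0 hμ'.2]
  have hT := hR.T_isBigO_rpow hP hbdd hne hd hS (A := (2 / (ν * ζ)) ^ (1 - μ)) hμ'.1 hr0.le hr1 hrμ
    hs (by positivity)
    (hgrad.mono fun k hk => hC.norm_sub_sq_le hμ hζ hk (hR.v_mem k) (hR.x_mem hP k))
  exact hT.trans (IsBigO.of_norm_le fun k =>
    (Real.norm_of_nonneg (by positivity)).trans_le (rpow_neg_min_le k _ _))

end IsShortStepRun

section Conversion

variable {n m : ℕ} {f : E n → ℝ} {g : Fin m → E n → ℝ} {C : Set (E n)} {Lf : ℝ}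
  {Lg B : Fin m → ℝ}

theorem ProblemAssumption.smoothConvexProblem (hprob : ProblemAssumption f g C Lf Lg)
    (hB : GradBound g C B) : SmoothConvexProblem f g C Lf Lg B where
  f_convex := hprob.f_convex.subset (Set.subset_univ C) hprob.C_convex
  f_diff x _ := hprob.f_diff x
  Lf_pos := hprob.Lf_pos
  f_grad_lip x _ y _ := hprob.f_lip x y
  g_convex i := (hprob.g_convex i).subset (Set.subset_univ C) hprob.C_convex
  g_diff i x _ := hprob.g_diff i x
  Lg_nonneg i := (hprob.Lg_pos i).le
  g_grad_lip := hprob.g_lip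
  g_lip := hB.lip

namespace IsKKT

variable {xs : E n} {zs : E m}

theorem mem_feasible (hk : IsKKT f g C xs zs) : xs ∈ feasible g C := by
  obtain ⟨w, hw, -⟩ := hk.stationary
  exact ⟨hw.1, hk.primal⟩

theorem le_lagrangian (hP : SmoothConvexProblem f g C Lf Lg B) (hk : IsKKT f g C xs zs)
    {x : E n} (hx : x ∈ C) : f xs ≤ f x + ∑ i, zs i * g i x := by
  obtain ⟨w, ⟨hxs, hw⟩, hstat⟩ := hk.stationary
  have hf := add_inner_gradient_le hP.f_convex (hP.f_diff xs hxs) hxs hx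
  have hg := Finset.sum_le_sum fun i (_ : i ∈ Finset.univ) => mul_le_mul_of_nonneg_left
    (add_inner_gradient_le (hP.g_convex i) (hP.g_diff i xs hxs) hxs hx) (hk.dual i)
  have hinner := congrArg (fun u => inner ℝ u (x - xs)) hstat
  simp only [inner_add_left, sum_inner, real_inner_smul_left, inner_zero_left] at hinner
  simp only [mul_add, Finset.sum_add_distrib, hk.compl] at hg
  linarith [hw x hx]

theorem isDualOptimal (hP : SmoothConvexProblem f g C Lf Lg B) (hk : IsKKT f g C xs zs) :
    IsDualOptimal f g C zs where
  nonneg := hk.dual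
  optVal_le x hx := by
    have hleast : IsLeast (f '' feasible g C) (f xs) := by
      refine ⟨⟨xs, hk.mem_feasible, rfl⟩, ?_⟩
      rintro _ ⟨y, hy, rfl⟩
      exact (hk.le_lagrangian hP hy.1).trans (add_le_of_nonpos_right (Finset.sum_nonpos
        fun i _ => mul_nonpos_of_nonneg_of_nonpos (hk.dual i) (hy.2 i)))
    exact hleast.csInf_eq.trans_le (hk.le_lagrangian hP hx)

end IsKKT

variable {τ : ℝ} {α lam σ : ℕ → ℝ} {x : ℕ → E n} {z : ℕ → E m} {v : ℕ → E n}

theorem IsGenerated.isShortStepRun (halg : IsGenerated f g C α lam σ x z v)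
    (hpar : ShortStepParams f g Lf Lg B τ α lam σ x z v) :
    IsShortStepRun f g C Lf Lg B lam σ x z v where
  x_zero := halg.x_zero
  z_zero := halg.z_zero
  lam_pos := halg.lam_pos
  lam_mono := halg.lam_mono.monotone
  sigma_nonneg k := (halg.sigma_pos k).le
  sigma_le := halg.sigma_le
  v_mem := halg.v_mem
  x_succ k := by rw [halg.x_succ, hpar.alpha_eq]
  z_succ k := by
    ext i
    exact halg.z_succ k i

theorem ShortStepParams.penaltySchedule (hpar : ShortStepParams f g Lf Lg B τ α lam σ x z v)
    (hσ : Summable σ) : PenaltySchedule τ lam σ where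
  tau_mem := hpar.tau_mem
  lam_theta := hpar.lam_theta
  lam_diff := hpar.lam_diff
  sigma_summable := hσ
  sigma_isBigO := by
    obtain ⟨γ, hγ, hθ⟩ := hpar.sigma_theta
    exact hθ.1.trans (isBigO_natCast_rpow_of_le (by linarith [hpar.tau_mem.1]))

end Conversion

end CGAL

open CGAL in
theorem proposition5p5_general {n m : ℕ} {f : E n → ℝ} {g : Fin m → E n → ℝ} {C : Set (E n)}
    {Lf : ℝ} {Lg B : Fin m → ℝ} {ν q μ τ : ℝ} {lam σ : ℕ → ℝ} {x : ℕ → E n} {z : ℕ → E m}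
    {v : ℕ → E n} (hP : SmoothConvexProblem f g C Lf Lg B) (hbdd : Bornology.IsBounded C)
    (hne : (feasible g C).Nonempty) (hdual : ∃ zs, IsDualOptimal f g C zs)
    (hC : UniformlyConvexSet ν q C) (haway : LagrangianGradBoundedAway f g C)
    (hR : IsShortStepRun f g C Lf Lg B lam σ x z v) (hS : PenaltySchedule τ lam σ)
    (hμ : μ = 1 - 2 / q) :
    (∀ k, x k ∈ C) ∧
    ((fun k : ℕ => T f g C (lam k) (x k) (z k)) =O[atTop]
      fun k : ℕ => max ((k : ℝ) ^ (-(1 / (1 + μ)))) ((k : ℝ) ^ (-((2 - 2 * τ) / (1 + μ))))) ∧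
    ((fun k : ℕ => max |f (x k) - optVal f g C| (infeas g (x k))) =O[atTop]
      fun k : ℕ => max (max ((k : ℝ) ^ (-(1 / (1 + μ)))) ((k : ℝ) ^ (-((2 - 2 * τ) / (1 + μ)))))
        ((k : ℝ) ^ (-τ))) ∧
    (q = 2 → τ = 2 / 3 →
      (fun k : ℕ => max |f (x k) - optVal f g C| (infeas g (x k))) =O[atTop]
        fun k : ℕ => (k : ℝ) ^ (-(2 / 3 : ℝ))) := by
  obtain ⟨zs, hd⟩ := hdual
  have hT := hR.T_isBigO hP hbdd hne hd hS hC haway hμ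
  have hres := (hR.residual_isBigO hP hbdd hd hS).trans (isBigO_max
    (hT.trans (isBigO_max_left (v := fun k : ℕ => (k : ℝ) ^ (-τ)) fun k => by positivity))
    (isBigO_max_right fun k => by positivity))
  refine ⟨hR.x_mem hP, hT, hres, ?_⟩
  rintro rfl rfl
  have hμ0 : μ = 0 := by rw [hμ, div_self two_ne_zero, sub_self]
  refine hres.trans (isBigO_max (isBigO_max ?_ ?_) (isBigO_refl _ _)) <;>
    exact isBigO_natCast_rpow_of_le (by norm_num [hμ0])

theorem proposition5p5 {n m : ℕ} (f : E n → ℝ) (g : Fin m → E n → ℝ) (C : Set (E n))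
    (Lf : ℝ) (Lg B : Fin m → ℝ) (ν q μ τ : ℝ)
    (α lam σ : ℕ → ℝ) (x : ℕ → E n) (z : ℕ → E m) (v : ℕ → E n)
    (hprob : CGAL.ProblemAssumption f g C Lf Lg)
    (hB : CGAL.GradBound g C B)
    (hC : CGAL.UniformlyConvexSet ν q C)
    (haway : CGAL.LagrangianGradBoundedAway f g C)
    (halg : CGAL.IsGenerated f g C α lam σ x z v)
    (hpar : CGAL.ShortStepParams f g Lf Lg B τ α lam σ x z v)
    (hμ : μ = 1 - 2 / q) :
    (∀ k, x k ∈ C) ∧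
    ((fun k : ℕ => CGAL.T f g C (lam k) (x k) (z k)) =O[atTop]
      fun k : ℕ => max ((k : ℝ) ^ (-(1 / (1 + μ)))) ((k : ℝ) ^ (-((2 - 2 * τ) / (1 + μ))))) ∧
    ((fun k : ℕ => max |f (x k) - CGAL.optVal f g C| (CGAL.infeas g (x k))) =O[atTop]
      fun k : ℕ => max (max ((k : ℝ) ^ (-(1 / (1 + μ)))) ((k : ℝ) ^ (-((2 - 2 * τ) / (1 + μ)))))
        ((k : ℝ) ^ (-τ))) ∧
    (q = 2 → τ = 2 / 3 →
      (fun k : ℕ => max |f (x k) - CGAL.optVal f g C| (CGAL.infeas g (x k))) =O[atTop]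
        fun k : ℕ => (k : ℝ) ^ (-(2 / 3 : ℝ))) := by
  obtain ⟨xs, zs, hkkt⟩ := hprob.kkt
  have hP := hprob.smoothConvexProblem hB
  exact proposition5p5_general hP hprob.C_compact.isBounded ⟨xs, hkkt.mem_feasible⟩
    ⟨zs, hkkt.isDualOptimal hP⟩ hC haway (halg.isShortStepRun hpar)
    (hpar.penaltySchedule halg.sigma_summable) hμ
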